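/- Let $L^2=L^2(\mathbb{R}^3;\mathbb{C})$ and let $H_0=-\tfrac12\Delta$ be the self-adjoint operator on $L^2$ with domain $H^2(\mathbb{R}^3)$; its square root $H_0^{1/2}$ has domain $H^1(\mathbb{R}^3)$ and symbol $|\xi|/\sqrt2$ in Fourier space. A bounded operator $T$ on $L^2$ is trace class if $\|T\|_1:=\operatorname{Tr}|T|<\infty$. Let $Z$ be the set of all Hermitian trace class operators $\rho$ on $L^2$ such that $H_0^{1/2}\rho H_0^{1/2}$ is defined on all of $H^1(\mathbb{R}^3)$ and its closure $\overline{H_0^{1/2}\rho H_0^{1/2}}$ is a trace class operator on $L^2$, with $$\|\rho\|_Z:=\|\rho\|_1+\big\|\overline{H_0^{1/2}\rho H_0^{1/2}}\big\|_1 .$$ Let $Y$ be the set of all Hermitian trace class operators $\rho$ on $L^2$ such that $H_0\rho$ is (defined on all of $L^2$ and) trace class, with $$\|\rho\|_Y:=\|\rho\|_1+\|H_0\rho\|_1 .$$ Then: (a) $(Z,\|\cdot\|_Z)$ is a real Banach space. (b) $(Y,\|\cdot\|_Y)$ is a real Banach space. (c) $Y$ is a dense subspace of $Z$: $Y$ is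 a linear subspace of $Z$, and it is dense in $Z$ with respect to $\|\cdot\|_Z$. -/

import Mathlib

noncomputable section

namespace HartreeFock

open MeasureTheory FourierTransform TemperedDistribution Laplacian
open scoped ENNReal SchwartzMap

/-! ### Trace class operators -/

section TraceClass

variable {H : Type*} [NormedAddCommGroup H] [InnerProductSpace ℂ H] [CompleteSpace H]

/-- Trace of a positive bounded operator, as a value in `[0, ∞]`: the sum of the diagonal matrix
elements in a Hilbert basis (for a positive operator the choice of the basis is irrelevant). -/
def posTrace (T : H →L[ℂ] H) : ℝ≥0∞ :=
  ∑' i, ENNReal.ofReal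
    (RCLike.re (inner ℂ ((exists_hilbertBasis ℂ H).choose_spec.choose i)
      (T ((exists_hilbertBasis ℂ H).choose_spec.choose i))))

/-- `Tr |T|`, where `|T| = (T* T)^{1/2}`. -/
def traceNorm (T : H →L[ℂ] H) : ℝ≥0∞ := posTrace (CFC.abs T)

/-- The trace norm of a possibly unbounded operator `T`: it is the trace norm of `γ` if `T` is the
everywhere defined bounded operator `γ`, and `∞` if `T` is not of this form. -/
def pTraceNorm (T : H →ₗ.[ℂ] H) : ℝ≥0∞ :=
  ⨅ (γ : H →L[ℂ] H) (_ : T = (γ : H →ₗ[ℂ] H).toPMap ⊤), traceNorm γ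

/-- The product `S T` of unbounded operators on its natural domain `{x ∈ D(T) | T x ∈ D(S)}`. -/
def pcomp (S T : H →ₗ.[ℂ] H) : H →ₗ.[ℂ] H :=
  S.comp (T.domRestrict ((S.domain.comap T.toFun).map T.domain.subtype)) (by
    rintro ⟨x, hx, hx'⟩
    obtain ⟨y, hy, rfl⟩ := hx
    exact hy)

end TraceClass

/-! ### The free Hamiltonian on `L²(ℝ³)` -/

/-- The Hilbert space `L²(ℝ³; ℂ)`. -/
abbrev L2 : Type := Lp (α := EuclideanSpace ℝ (Fin 3)) ℂ 2 volume

/-- The pairs `(f, g)` in `L² × L²` with `g = -Δ f / 2` in the sense of tempered distributions. -/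
def freeHamiltonianGraph : Submodule ℂ (L2 × L2) where
  carrier := {p | (p.2 : 𝓢'(EuclideanSpace ℝ (Fin 3), ℂ)) =
    (-(1 / 2) : ℂ) • Δ (p.1 : 𝓢'(EuclideanSpace ℝ (Fin 3), ℂ))}
  zero_mem' := by
    simp [← Lp.toTemperedDistributionCLM_apply, ← laplacianCLM_apply]
  add_mem' {p q} hp hq := by
    simp only [Set.mem_ofPred_eq, ← Lp.toTemperedDistributionCLM_apply,
      ← laplacianCLM_apply] at hp hq ⊢
    simp only [Prod.fst_add, Prod.snd_add, map_add, smul_add, hp, hq]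
  smul_mem' c p hp := by
    simp only [Set.mem_ofPred_eq, ← Lp.toTemperedDistributionCLM_apply,
      ← laplacianCLM_apply] at hp ⊢
    simp only [Prod.smul_fst, Prod.smul_snd, map_smul, hp]
    rw [smul_comm]

/-- `H₀ = -Δ/2` on its maximal domain `{f ∈ L² | Δ f ∈ L²} = H²(ℝ³)`. -/
def freeHamiltonian : L2 →ₗ.[ℂ] L2 := freeHamiltonianGraph.toLinearPMap

theorem graph_freeHamiltonian : freeHamiltonian.graph = freeHamiltonianGraph := by
  refine Submodule.toLinearPMap_graph_eq _ ?_
  rintro ⟨f, g⟩ hx (rfl : f = 0)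
  have hx' : Lp.toTemperedDistributionCLM ℂ volume 2 g = 0 := by
    have h : (g : 𝓢'(EuclideanSpace ℝ (Fin 3), ℂ)) =
      (-(1 / 2) : ℂ) • Δ ((0 : L2) : 𝓢'(EuclideanSpace ℝ (Fin 3), ℂ)) := hx
    simpa [← Lp.toTemperedDistributionCLM_apply, ← laplacianCLM_apply] using h
  have h := LinearMap.mem_ker.2 hx'
  rwa [Lp.ker_toTemperedDistributionCLM_eq_bot, Submodule.mem_bot] at h

/-- The pairs `(f, g)` in `L² × L²` with `𝓕 g (ξ) = (|ξ|/√2) 𝓕 f (ξ)`. Since Mathlib normalizes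
`𝓕` with `exp (-2πi⟨x, ξ⟩)`, the symbol `|ξ|/√2` reads `2π|ξ|/√2` here. -/
def sqrtFreeHamiltonianGraph : Submodule ℂ (L2 × L2) where
  carrier := {p | ∀ᵐ ξ, (𝓕 p.2 : L2) ξ =
    ((2 * Real.pi * ‖ξ‖ / Real.sqrt 2 : ℝ) : ℂ) * (𝓕 p.1 : L2) ξ}
  zero_mem' := by
    have h : (𝓕 (0 : L2) : L2) = 0 := map_zero (Lp.fourierTransformₗᵢ _ _)
    simp only [Set.mem_ofPred_eq, Prod.fst_zero, Prod.snd_zero, h]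
    filter_upwards with ξ
    simp
  add_mem' {p q} hp hq := by
    simp only [Set.mem_ofPred_eq, Prod.fst_add, Prod.snd_add, FourierTransform.fourier_add] at hp hq ⊢
    filter_upwards [hp, hq, Lp.coeFn_add (𝓕 p.1 : L2) (𝓕 q.1), Lp.coeFn_add (𝓕 p.2 : L2) (𝓕 q.2)]
      with ξ h1 h2 h3 h4
    rw [h3, h4, Pi.add_apply, Pi.add_apply, h1, h2, mul_add]
  smul_mem' c p hp := by
    simp only [Set.mem_ofPred_eq, Prod.smul_fst, Prod.smul_snd, FourierTransform.fourier_smul] at hp ⊢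
    filter_upwards [hp, Lp.coeFn_smul c (𝓕 p.1 : L2), Lp.coeFn_smul c (𝓕 p.2 : L2)]
      with ξ h1 h3 h4
    rw [h3, h4, Pi.smul_apply, Pi.smul_apply, h1, smul_eq_mul, smul_eq_mul, mul_left_comm]

/-- `H₀^{1/2}`, the operator with the symbol `|ξ|/√2`, on its maximal domain `H¹(ℝ³)`. -/
def sqrtFreeHamiltonian : L2 →ₗ.[ℂ] L2 := sqrtFreeHamiltonianGraph.toLinearPMap

theorem graph_sqrtFreeHamiltonian : sqrtFreeHamiltonian.graph = sqrtFreeHamiltonianGraph := by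
  refine Submodule.toLinearPMap_graph_eq _ ?_
  rintro ⟨f, g⟩ hx (rfl : f = 0)
  have h0 : (𝓕 (0 : L2) : L2) = 0 := map_zero (Lp.fourierTransformₗᵢ _ _)
  have hx' : ∀ᵐ ξ, (𝓕 g : L2) ξ =
    ((2 * Real.pi * ‖ξ‖ / Real.sqrt 2 : ℝ) : ℂ) * (𝓕 (0 : L2) : L2) ξ := hx
  rw [h0] at hx'
  have h1 : (𝓕 g : L2) = 0 := by
    refine Lp.ext ?_
    filter_upwards [hx', Lp.coeFn_zero ℂ 2 (volume : Measure (EuclideanSpace ℝ (Fin 3)))]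
      with ξ h2 h3
    rw [h2, h3]
    simp
  have h4 := Lp.norm_fourier_eq g
  rw [h1, norm_zero] at h4
  exact norm_eq_zero.1 h4.symm

/-- `H₀` has the symbol `|ξ|²/2` (with `ξ` replaced by `2πξ`, as above). -/
theorem mem_freeHamiltonianGraph_iff (f g : L2) : (f, g) ∈ freeHamiltonianGraph ↔
    ∀ᵐ ξ, (𝓕 g : L2) ξ = (((2 * Real.pi * ‖ξ‖) ^ 2 / 2 : ℝ) : ℂ) * (𝓕 f : L2) ξ := by
  have e1 : (f, g) ∈ freeHamiltonianGraph ↔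
      ((𝓕 g : L2) : 𝓢'((EuclideanSpace ℝ (Fin 3)), ℂ)) = ((2 * Real.pi) ^ 2 / 2 : ℂ) •
        smulLeftCLM ℂ (fun x : (EuclideanSpace ℝ (Fin 3)) ↦ Complex.ofReal (‖x‖ ^ 2)) ((𝓕 f : L2) : 𝓢'((EuclideanSpace ℝ (Fin 3)), ℂ)) := by
    change (g : 𝓢'((EuclideanSpace ℝ (Fin 3)), ℂ)) = (-(1 / 2) : ℂ) • Δ (f : 𝓢'((EuclideanSpace ℝ (Fin 3)), ℂ)) ↔ _
    rw [← Lp.fourier_toTemperedDistribution_eq, ← Lp.fourier_toTemperedDistribution_eq,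
      laplacian_eq_fourierMultiplierCLM, fourierMultiplierCLM_apply]
    rw [← (FourierTransform.fourierEquiv ℂ 𝓢'((EuclideanSpace ℝ (Fin 3)), ℂ)).injective.eq_iff]
    simp only [FourierTransform.fourierEquiv_apply, FourierTransform.fourier_smul]
    rw [← Complex.coe_smul (-(2 * Real.pi) ^ 2)]
    simp only [FourierTransform.fourier_smul, FourierTransform.fourier_fourierInv_eq, smul_smul]
    push_cast
    rw [show (-(1 / 2) * -(2 * (Real.pi:ℂ)) ^ 2 ) = (2 * Real.pi) ^ 2 / 2 by ring]
  rw [e1]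
  have hg : (fun x : (EuclideanSpace ℝ (Fin 3)) ↦ Complex.ofReal (‖x‖ ^ 2)).HasTemperateGrowth := by fun_prop
  have key : ∀ u : 𝓢((EuclideanSpace ℝ (Fin 3)), ℂ), (((2 * Real.pi) ^ 2 / 2 : ℂ) •
        smulLeftCLM ℂ (fun x : (EuclideanSpace ℝ (Fin 3)) ↦ Complex.ofReal (‖x‖ ^ 2)) ((𝓕 f : L2) : 𝓢'((EuclideanSpace ℝ (Fin 3)), ℂ))) u
        = ∫ x, u x • ((((2 * Real.pi * ‖x‖) ^ 2 / 2 : ℝ) : ℂ) * (𝓕 f : L2) x) := by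
    intro u
    change ((2 * Real.pi) ^ 2 / 2 : ℂ) • (smulLeftCLM ℂ (fun x : (EuclideanSpace ℝ (Fin 3)) ↦ Complex.ofReal (‖x‖ ^ 2)) ((𝓕 f : L2) : 𝓢'((EuclideanSpace ℝ (Fin 3)), ℂ)) u) = _
    rw [smulLeftCLM_apply_apply, Lp.toTemperedDistribution_apply, ← integral_smul]
    congr 1
    ext x
    rw [SchwartzMap.smulLeftCLM_apply_apply hg]
    simp; ring
  have hloc : ∀ h : L2, LocallyIntegrable (h : (EuclideanSpace ℝ (Fin 3)) → ℂ) volume := fun h =>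
    (Lp.memLp h).locallyIntegrable (by norm_num)
  constructor
  · intro h
    have hl : LocallyIntegrable (fun x : (EuclideanSpace ℝ (Fin 3)) => (((2 * Real.pi * ‖x‖) ^ 2 / 2 : ℝ) : ℂ) * (𝓕 f : L2) x) volume := by
      have := (hloc (𝓕 f)).locallyIntegrableOn Set.univ
      rw [← locallyIntegrableOn_univ]
      exact this.continuousOn_mul (by fun_prop) isOpen_univ.isLocallyClosed
    have := ae_eq_of_integral_contDiff_smul_eq (hloc (𝓕 g)) hl ?_
    · exact this
    intro φ h1 h2
    have hφ : ContDiff ℝ (⊤:ℕ∞) (fun x => (φ x : ℂ)) :=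
      Complex.ofRealCLM.contDiff.comp h1
    have h2' : HasCompactSupport (fun x => (φ x : ℂ)) := h2.comp_left (g := Complex.ofReal) rfl
    have h3 := congrArg (fun T : 𝓢'((EuclideanSpace ℝ (Fin 3)), ℂ) => T (h2'.toSchwartzMap hφ)) h
    simp only [key] at h3
    rw [Lp.toTemperedDistribution_apply] at h3
    simpa using h3
  · intro h
    ext u
    rw [key, Lp.toTemperedDistribution_apply]
    apply integral_congr_ae
    filter_upwards [h] with x hx
    rw [hx]

/-- `H₀^{1/2} H₀^{1/2} = H₀`, including the domains. -/
theorem mem_freeHamiltonianGraph_iff_sqrt (f h : L2) : (f, h) ∈ freeHamiltonianGraph ↔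
    ∃ g, (f, g) ∈ sqrtFreeHamiltonianGraph ∧ (g, h) ∈ sqrtFreeHamiltonianGraph := by
  have hm : ∀ x : ℝ, ((2 * Real.pi * x / √2 : ℝ):ℂ) * ((2 * Real.pi * x / √2 : ℝ):ℂ) = (((2 * Real.pi * x) ^ 2 / 2 : ℝ) : ℂ) := by
    intro x
    rw [← Complex.ofReal_mul]
    congr 1
    rw [div_mul_div_comm, Real.mul_self_sqrt (by norm_num)]; ring
  rw [mem_freeHamiltonianGraph_iff]
  constructor
  · intro hh
    have hmem : MemLp (fun ξ : (EuclideanSpace ℝ (Fin 3)) => ((2 * Real.pi * ‖ξ‖ / √2 : ℝ):ℂ) * (𝓕 f : L2) ξ) 2 volume := by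
      have hs := (Lp.memLp (𝓕 f : L2)).norm.add (Lp.memLp (𝓕 h : L2)).norm
      refine hs.mono (by
        refine AEStronglyMeasurable.mul ?_ (Lp.memLp (𝓕 f : L2)).1
        exact (by fun_prop : Continuous fun ξ : (EuclideanSpace ℝ (Fin 3)) => ((2 * Real.pi * ‖ξ‖ / √2 : ℝ):ℂ)).aestronglyMeasurable) ?_
      filter_upwards [hh] with ξ hξ
      simp only [Pi.add_apply]
      rw [hξ, ← hm, norm_mul, norm_mul, norm_mul]
      set a := ‖((2 * Real.pi * ‖ξ‖ / √2 : ℝ):ℂ)‖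
      set b := ‖(𝓕 f : L2) ξ‖
      have ha : 0 ≤ a := norm_nonneg _
      have hb : 0 ≤ b := norm_nonneg _
      rw [Real.norm_of_nonneg (by positivity)]
      nlinarith [mul_nonneg hb (sq_nonneg (a - 1)), mul_nonneg hb (sq_nonneg a)]
    refine ⟨𝓕⁻ (hmem.toLp _), ?_, ?_⟩
    · change ∀ᵐ ξ, (𝓕 (𝓕⁻ (hmem.toLp _)) : L2) ξ = _
      rw [FourierTransform.fourier_fourierInv_eq]
      exact hmem.coeFn_toLp
    · change ∀ᵐ ξ, _ = _ * (𝓕 (𝓕⁻ (hmem.toLp _)) : L2) ξ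
      rw [FourierTransform.fourier_fourierInv_eq]
      filter_upwards [hh, hmem.coeFn_toLp] with ξ h1 h2
      rw [h1, h2, ← hm, mul_assoc]
  · rintro ⟨g, h1, h2⟩
    filter_upwards [h1, h2] with ξ h1 h2
    rw [h2, h1, ← hm]
    ring

/-- `H₀ ρ` on its natural domain. -/
def leftProd (ρ : L2 →L[ℂ] L2) : L2 →ₗ.[ℂ] L2 :=
  pcomp freeHamiltonian ((ρ : L2 →ₗ[ℂ] L2).toPMap ⊤)

/-- `H₀^{1/2} ρ H₀^{1/2}` on its natural domain. -/
def sandwich (ρ : L2 →L[ℂ] L2) : L2 →ₗ.[ℂ] L2 :=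
  pcomp sqrtFreeHamiltonian ((ρ : L2 →ₗ[ℂ] L2).compPMap sqrtFreeHamiltonian)

/-! ### The spaces `Z` and `Y` -/

/-- The Hermitian trace class `ρ` for which `H₀^{1/2} ρ H₀^{1/2}` is defined on all of `H¹(ℝ³)`,
the domain of `H₀^{1/2}`, and has a trace class closure. -/
def Z : Set (L2 →L[ℂ] L2) :=
  {ρ | IsSelfAdjoint ρ ∧ traceNorm ρ < ∞ ∧ sqrtFreeHamiltonian.domain ≤ (sandwich ρ).domain ∧
    pTraceNorm (sandwich ρ).closure < ∞}

def normZ (ρ : L2 →L[ℂ] L2) : ℝ :=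
  (traceNorm ρ + pTraceNorm (sandwich ρ).closure).toReal

/-- The Hermitian trace class `ρ` for which `H₀ ρ` is trace class (in particular defined on all
of `L²`). -/
def Y : Set (L2 →L[ℂ] L2) :=
  {ρ | IsSelfAdjoint ρ ∧ traceNorm ρ < ∞ ∧ pTraceNorm (leftProd ρ) < ∞}

def normY (ρ : L2 →L[ℂ] L2) : ℝ :=
  (traceNorm ρ + pTraceNorm (leftProd ρ)).toReal

universe u

/-- The subset `S` of the real vector space `V` is a linear subspace, and `N` restricts to a norm
on `S` that makes it a Banach space: `S` is the image of a real Banach space under an injective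
linear map that turns its norm into `N`. -/
def IsRealBanachSpace {V : Type u} [AddCommGroup V] [Module ℝ V] (S : Set V) (N : V → ℝ) : Prop :=
  ∃ (E : Type u) (_ : NormedAddCommGroup E) (_ : NormedSpace ℝ E) (j : E →ₗ[ℝ] V),
    CompleteSpace E ∧ Function.Injective j ∧ Set.range j = S ∧ ∀ x, ‖x‖ = N (j x)

end HartreeFock

end

/-!
The trace norm of `T` equals the supremum of `∑ i, |⟪f i, T (e i)⟫|` over finite families `e`, `f`
satisfying Bessel's inequality. Such families stay so under contractions and under passing to
adjoints, so the triangle inequality, the ideal property, `‖T⋆‖₁ = ‖T‖₁` and lower semicontinuity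
under pointwise convergence all follow from the formula. Since `H₀^{1/2}` and `H₀` are closed,
lower semicontinuity makes limits of Cauchy sequences in `Z` and `Y` stay in these spaces.

Only the self-adjointness of `A = H₀^{1/2}` matters. The cutoffs `P = s (s + A²)⁻¹` are
contractions, commute with `A`, and tend strongly to `1`, while `B = A P` is bounded. For `ρ ∈ Y`,
`‖B ρ B‖₁ ≤ ‖B² ρ‖₁ = ‖P² A² ρ‖₁ ≤ ‖A² ρ‖₁`, and `s → ∞` gives `ρ ∈ Z`. For `ρ ∈ Z`, the operators
`P ρ P` lie in `Y` and converge to `ρ` in `Z`.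
-/

noncomputable section

namespace HartreeFock

open Filter Topology ContinuousLinearMap
open scoped ENNReal

/-! ### Bessel families and the variational trace norm -/

section Bessel

variable {𝕜 E F G : Type*} [RCLike 𝕜] [NormedAddCommGroup E] [InnerProductSpace 𝕜 E]
  [NormedAddCommGroup F] [InnerProductSpace 𝕜 F] [NormedAddCommGroup G] [InnerProductSpace 𝕜 G]
  {ι : Type*} [Fintype ι]

variable (𝕜) in
/-- A finite family satisfying Bessel's inequality. Unlike orthonormal families, these are stable
under contractions. -/
def IsBessel (e : ι → E) : Prop :=
  ∀ x, ∑ i, ‖inner 𝕜 (e i) x‖ₑ ^ 2 ≤ ‖x‖ₑ ^ 2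

/-- The trace norm in its variational form, as a supremum over pairs of Bessel families. -/
def besselNorm (T : E →L[𝕜] F) : ℝ≥0∞ :=
  ⨆ (n : ℕ) (e : Fin n → E) (f : Fin n → F) (_ : IsBessel 𝕜 e) (_ : IsBessel 𝕜 f),
    ∑ i, ‖inner 𝕜 (f i) (T (e i))‖ₑ

theorem isBessel_of_orthonormal {e : ι → E} (he : Orthonormal 𝕜 e) : IsBessel 𝕜 e := by
  intro x
  have h := ENNReal.ofReal_le_ofReal (he.sum_inner_products_le x (s := Finset.univ))
  rw [ENNReal.ofReal_sum_of_nonneg fun _ _ => sq_nonneg _] at h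
  simpa only [ENNReal.ofReal_pow (norm_nonneg _), ofReal_norm] using h

theorem isBessel_const_of_norm_eq_one {x : E} (hx : ‖x‖ = 1) :
    IsBessel 𝕜 fun _ : Fin 1 => x :=
  isBessel_of_orthonormal (orthonormal_subsingleton_iff.2 fun _ => hx)

theorem besselNorm_le_iff {T : E →L[𝕜] F} {C : ℝ≥0∞} : besselNorm T ≤ C ↔
    ∀ (n : ℕ) (e : Fin n → E) (f : Fin n → F), IsBessel 𝕜 e → IsBessel 𝕜 f →
      ∑ i, ‖inner 𝕜 (f i) (T (e i))‖ₑ ≤ C := by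
  simp only [besselNorm, iSup_le_iff]

theorem sum_enorm_inner_le_besselNorm (T : E →L[𝕜] F) {n : ℕ} {e : Fin n → E} {f : Fin n → F}
    (he : IsBessel 𝕜 e) (hf : IsBessel 𝕜 f) :
    ∑ i, ‖inner 𝕜 (f i) (T (e i))‖ₑ ≤ besselNorm T :=
  besselNorm_le_iff.1 le_rfl n e f he hf

theorem tsum_enorm_inner_le_besselNorm (T : E →L[𝕜] E) {κ : Type*} {b : κ → E}
    (hb : Orthonormal 𝕜 b) : ∑' i, ‖inner 𝕜 (b i) (T (b i))‖ₑ ≤ besselNorm T := by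
  refine ENNReal.summable.tsum_le_of_sum_le fun s => ?_
  have hs : IsBessel 𝕜 fun k : Fin s.card => b (s.equivFin.symm k) :=
    isBessel_of_orthonormal (hb.comp _ (Subtype.val_injective.comp s.equivFin.symm.injective))
  rw [← Finset.sum_coe_sort, ← s.equivFin.symm.sum_comp]
  exact sum_enorm_inner_le_besselNorm T hs hs

theorem besselNorm_add_le (S T : E →L[𝕜] F) :
    besselNorm (S + T) ≤ besselNorm S + besselNorm T := by
  refine besselNorm_le_iff.2 fun n e f he hf => ?_
  calc ∑ i, ‖inner 𝕜 (f i) ((S + T) (e i))‖ₑ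
      ≤ ∑ i, (‖inner 𝕜 (f i) (S (e i))‖ₑ + ‖inner 𝕜 (f i) (T (e i))‖ₑ) := by
        gcongr with i
        rw [add_apply, inner_add_right]
        exact enorm_add_le _ _
    _ ≤ besselNorm S + besselNorm T := by
        rw [Finset.sum_add_distrib]
        exact add_le_add (sum_enorm_inner_le_besselNorm S he hf)
          (sum_enorm_inner_le_besselNorm T he hf)

theorem besselNorm_smul_le (c : 𝕜) (T : E →L[𝕜] F) :
    besselNorm (c • T) ≤ ‖c‖ₑ * besselNorm T := by
  refine besselNorm_le_iff.2 fun n e f he hf => ?_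
  simp only [smul_apply, inner_smul_right, enorm_mul, ← Finset.mul_sum]
  gcongr
  exact sum_enorm_inner_le_besselNorm T he hf

theorem enorm_le_besselNorm (T : E →L[𝕜] F) : ‖T‖ₑ ≤ besselNorm T := by
  by_cases hT : besselNorm T = ∞
  · exact hT ▸ le_top
  rw [← ofReal_norm]
  refine ENNReal.ofReal_le_of_le_toReal
    (opNorm_le_of_re_inner_le (𝕜 := 𝕜) ENNReal.toReal_nonneg fun x y hx hy => ?_)
  have h := sum_enorm_inner_le_besselNorm T (isBessel_const_of_norm_eq_one hx)
    (isBessel_const_of_norm_eq_one hy)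
  rw [Fin.sum_univ_one, ← ofReal_norm, norm_inner_symm] at h
  exact (RCLike.re_le_norm _).trans ((ENNReal.ofReal_le_iff_le_toReal hT).1 h)

theorem besselNorm_le_of_tendsto {κ : Type*} {l : Filter κ} [l.NeBot] {T : κ → E →L[𝕜] F}
    {S : E →L[𝕜] F} {C : ℝ≥0∞} (hT : ∀ x, Tendsto (fun k => T k x) l (𝓝 (S x)))
    (hC : ∀ᶠ k in l, besselNorm (T k) ≤ C) : besselNorm S ≤ C := by
  refine besselNorm_le_iff.2 fun n e f he hf => ?_
  have hsum : Tendsto (fun k => ∑ i, ‖inner 𝕜 (f i) (T k (e i))‖ₑ) l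
      (𝓝 (∑ i, ‖inner 𝕜 (f i) (S (e i))‖ₑ)) :=
    tendsto_finsetSum _ fun i _ => (tendsto_const_nhds.inner (hT (e i))).enorm
  exact le_of_tendsto hsum (hC.mono fun k hk =>
    (sum_enorm_inner_le_besselNorm _ he hf).trans hk)

variable [CompleteSpace F]

theorem IsBessel.map [CompleteSpace E] {e : ι → E} (he : IsBessel 𝕜 e) {U : E →L[𝕜] F}
    (hU : ‖U‖ ≤ 1) : IsBessel 𝕜 fun i => U (e i) := by
  intro x
  have hUx : ‖adjoint U x‖ ≤ ‖x‖ := by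
    have hU' : ‖adjoint U‖ ≤ 1 := by rwa [LinearIsometryEquiv.norm_map]
    simpa only [one_mul] using (adjoint U).le_of_opNorm_le hU' x
  calc ∑ i, ‖inner 𝕜 (U (e i)) x‖ₑ ^ 2
      = ∑ i, ‖inner 𝕜 (e i) (adjoint U x)‖ₑ ^ 2 := by simp only [adjoint_inner_right]
    _ ≤ ‖adjoint U x‖ₑ ^ 2 := he _
    _ ≤ ‖x‖ₑ ^ 2 := by gcongr; exact enorm_le_iff_norm_le.2 hUx

theorem besselNorm_comp_contraction_le [CompleteSpace E] {U : E →L[𝕜] F} (hU : ‖U‖ ≤ 1)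
    (T : F →L[𝕜] G) : besselNorm (T ∘L U) ≤ besselNorm T :=
  besselNorm_le_iff.2 fun _ _ _ he hf => sum_enorm_inner_le_besselNorm T (he.map hU) hf

theorem besselNorm_adjoint_le [CompleteSpace E] (T : E →L[𝕜] F) :
    besselNorm (adjoint T) ≤ besselNorm T := by
  refine besselNorm_le_iff.2 fun n e f he hf => ?_
  calc ∑ i, ‖inner 𝕜 (f i) (adjoint T (e i))‖ₑ
      = ∑ i, ‖inner 𝕜 (e i) (T (f i))‖ₑ := by
        refine Finset.sum_congr rfl fun i _ => ?_
        rw [adjoint_inner_right, ← inner_conj_symm, RCLike.enorm_conj]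
    _ ≤ besselNorm T := sum_enorm_inner_le_besselNorm T hf he

theorem besselNorm_adjoint [CompleteSpace E] (T : E →L[𝕜] F) :
    besselNorm (adjoint T) = besselNorm T :=
  (besselNorm_adjoint_le T).antisymm (by simpa using besselNorm_adjoint_le (adjoint T))

theorem besselNorm_contraction_comp_le [CompleteSpace G] {U : F →L[𝕜] G} (hU : ‖U‖ ≤ 1)
    (T : E →L[𝕜] F) : besselNorm (U ∘L T) ≤ besselNorm T := by
  refine besselNorm_le_iff.2 fun n e f he hf => ?_
  simp only [comp_apply, ← adjoint_inner_left U]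
  exact sum_enorm_inner_le_besselNorm T he (hf.map (by rwa [LinearIsometryEquiv.norm_map]))

end Bessel

/-! ### Hilbert–Schmidt operators -/

section HilbertSchmidt

variable {𝕜 E F G : Type*} [RCLike 𝕜] [NormedAddCommGroup E] [InnerProductSpace 𝕜 E]
  [NormedAddCommGroup F] [InnerProductSpace 𝕜 F] [NormedAddCommGroup G] [InnerProductSpace 𝕜 G]
  {ι κ : Type*}

theorem tsum_enorm_inner_sq (b : HilbertBasis ι 𝕜 E) (x : E) :
    ∑' i, ‖inner 𝕜 (b i) x‖ₑ ^ 2 = ‖x‖ₑ ^ 2 := by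
  have h : HasSum (fun i => ‖inner 𝕜 (b i) x‖ ^ 2) (‖x‖ ^ 2) := by
    have hre := RCLike.hasSum_re 𝕜 (b.hasSum_inner_mul_inner x x)
    simpa only [← inner_conj_symm x (b _), RCLike.conj_mul, ← RCLike.ofReal_pow, RCLike.ofReal_re,
      inner_self_eq_norm_sq] using hre
  have hsum := ENNReal.ofReal_tsum_of_nonneg (fun i => sq_nonneg ‖inner 𝕜 (b i) x‖) h.summable
  rw [h.tsum_eq] at hsum
  simpa only [ENNReal.ofReal_pow (norm_nonneg _), ofReal_norm] using hsum.symm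

/-- The square of the Hilbert–Schmidt norm, computed in the Hilbert basis `b`. -/
def hsNormSq (b : HilbertBasis ι 𝕜 E) (S : E →L[𝕜] F) : ℝ≥0∞ := ∑' i, ‖S (b i)‖ₑ ^ 2

theorem hsNormSq_adjoint [CompleteSpace E] [CompleteSpace F] (b : HilbertBasis ι 𝕜 E)
    (c : HilbertBasis κ 𝕜 F) (S : E →L[𝕜] F) : hsNormSq c (adjoint S) = hsNormSq b S :=
  calc ∑' j, ‖adjoint S (c j)‖ₑ ^ 2
      = ∑' j, ∑' i, ‖inner 𝕜 (b i) (adjoint S (c j))‖ₑ ^ 2 := by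
        simp only [tsum_enorm_inner_sq b]
    _ = ∑' i, ∑' j, ‖inner 𝕜 (c j) (S (b i))‖ₑ ^ 2 := by
        rw [ENNReal.tsum_comm]
        refine tsum_congr fun i => tsum_congr fun j => ?_
        rw [adjoint_inner_right, ← inner_conj_symm, RCLike.enorm_conj]
    _ = ∑' i, ‖S (b i)‖ₑ ^ 2 := by simp only [tsum_enorm_inner_sq c]

theorem IsBessel.sum_enorm_sq_le_hsNormSq [CompleteSpace E] [CompleteSpace F] [Fintype κ]
    {e : κ → E} (he : IsBessel 𝕜 e) (b : HilbertBasis ι 𝕜 E) (S : E →L[𝕜] F) :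
    ∑ k, ‖S (e k)‖ₑ ^ 2 ≤ hsNormSq b S := by
  obtain ⟨s, c, -⟩ := exists_hilbertBasis 𝕜 F
  calc ∑ k, ‖S (e k)‖ₑ ^ 2 = ∑' j, ∑ k, ‖inner 𝕜 (c j) (S (e k))‖ₑ ^ 2 := by
        simp only [← tsum_enorm_inner_sq c (S _)]
        rw [Summable.tsum_finsetSum fun _ _ => ENNReal.summable]
    _ ≤ ∑' j, ‖adjoint S (c j)‖ₑ ^ 2 := by
        refine ENNReal.tsum_le_tsum fun j => le_trans (Finset.sum_le_sum fun k _ => ?_) (he _)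
        rw [adjoint_inner_right, ← inner_conj_symm, RCLike.enorm_conj]
    _ = hsNormSq b S := hsNormSq_adjoint b c S

theorem hsNormSq_comp_le (b : HilbertBasis ι 𝕜 E) (X : F →L[𝕜] G) (S : E →L[𝕜] F) :
    hsNormSq b (X ∘L S) ≤ ‖X‖ₑ ^ 2 * hsNormSq b S := by
  rw [hsNormSq, hsNormSq, ← ENNReal.tsum_mul_left]
  refine ENNReal.tsum_le_tsum fun i => ?_
  rw [← mul_pow]
  gcongr
  exact X.le_opENorm _

theorem besselNorm_comp_le_hsNormSq [CompleteSpace E] [CompleteSpace F] [CompleteSpace G]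
    (b : HilbertBasis ι 𝕜 E) (c : HilbertBasis κ 𝕜 F) (X : F →L[𝕜] G) (S : E →L[𝕜] F) :
    besselNorm (X ∘L S) ≤ hsNormSq c X ^ (1 / 2 : ℝ) * hsNormSq b S ^ (1 / 2 : ℝ) := by
  obtain ⟨s, d, -⟩ := exists_hilbertBasis 𝕜 G
  refine besselNorm_le_iff.2 fun n e f he hf => ?_
  have hS := he.sum_enorm_sq_le_hsNormSq b S
  have hX := hf.sum_enorm_sq_le_hsNormSq d (adjoint X)
  rw [hsNormSq_adjoint c d] at hX
  calc ∑ i, ‖inner 𝕜 (f i) ((X ∘L S) (e i))‖ₑ ≤ ∑ i, ‖adjoint X (f i)‖ₑ * ‖S (e i)‖ₑ := by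
        gcongr with i
        rw [comp_apply, ← adjoint_inner_left, ← ofReal_norm, ← ofReal_norm, ← ofReal_norm,
          ← ENNReal.ofReal_mul (norm_nonneg _)]
        exact ENNReal.ofReal_le_ofReal (norm_inner_le_norm _ _)
    _ ≤ (∑ i, ‖adjoint X (f i)‖ₑ ^ (2 : ℝ)) ^ (1 / 2 : ℝ) *
          (∑ i, ‖S (e i)‖ₑ ^ (2 : ℝ)) ^ (1 / 2 : ℝ) :=
        ENNReal.inner_le_Lp_mul_Lq _ _ _ .two_two
    _ ≤ hsNormSq c X ^ (1 / 2 : ℝ) * hsNormSq b S ^ (1 / 2 : ℝ) := by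
        simp only [ENNReal.rpow_two]
        gcongr

theorem tendsto_hsNormSq_comp {l : Filter κ} [l.IsCountablyGenerated] {Q : κ → F →L[𝕜] G} {C : ℝ}
    (hQ : ∀ᶠ k in l, ‖Q k‖ ≤ C) (hQ0 : ∀ x, Tendsto (fun k => Q k x) l (𝓝 0))
    (b : HilbertBasis ι 𝕜 E) {S : E →L[𝕜] F} (hS : hsNormSq b S ≠ ∞) :
    Tendsto (fun k => hsNormSq b (Q k ∘L S)) l (𝓝 0) := by
  let _ : MeasurableSpace ι := ⊤
  have hlim : ∀ i, Tendsto (fun k => ‖Q k (S (b i))‖ₑ ^ 2) l (𝓝 0) := fun i => by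
    simpa using ENNReal.Tendsto.pow (n := 2) (hQ0 (S (b i))).enorm
  simp only [hsNormSq] at hS ⊢
  simp only [← MeasureTheory.lintegral_count] at hS ⊢
  rw [← MeasureTheory.lintegral_zero (μ := (.count : MeasureTheory.Measure ι))]
  refine MeasureTheory.tendsto_lintegral_filter_of_dominated_convergence
    (fun i => ‖C‖ₑ ^ 2 * ‖S (b i)‖ₑ ^ 2) (.of_forall fun _ => measurable_from_top)
    (hQ.mono fun k hk => .of_forall fun i => ?_) ?_ (.of_forall hlim)
  · rw [← mul_pow]
    gcongr
    refine (Q k).le_of_opENorm_le (enorm_le_iff_norm_le.2 (hk.trans (Real.le_norm_self C))) _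
  · rw [MeasureTheory.lintegral_const_mul _ measurable_from_top]
    finiteness

theorem hsNormSq_add_add_hsNormSq_sub (b : HilbertBasis ι 𝕜 E) (X Y : E →L[𝕜] F) :
    hsNormSq b (X + Y) + hsNormSq b (X - Y) = 2 * (hsNormSq b X + hsNormSq b Y) := by
  simp only [hsNormSq]
  rw [← ENNReal.tsum_add, ← ENNReal.tsum_add, ← ENNReal.tsum_mul_left]
  refine tsum_congr fun i => ?_
  have h := congrArg ENNReal.ofReal (parallelogram_law_with_norm 𝕜 (X (b i)) (Y (b i)))
  rw [ENNReal.ofReal_mul zero_le_two] at h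
  simpa [ENNReal.ofReal_add, mul_self_nonneg, ← pow_two, ENNReal.ofReal_pow] using h

theorem hasSum_norm_sq_hsNormSq {b : HilbertBasis ι 𝕜 E} {S : E →L[𝕜] F}
    (hS : hsNormSq b S ≠ ∞) : HasSum (fun i => ‖S (b i)‖ ^ 2) (hsNormSq b S).toReal := by
  have h := ENNReal.hasSum_toReal (f := fun i => ‖S (b i)‖ₑ ^ 2) hS
  rw [hsNormSq, ENNReal.tsum_toReal_eq fun _ => by finiteness]
  simpa using h

theorem tsum_re_inner_eq_hsNormSq {b : HilbertBasis ι 𝕜 E} {X Y : E →L[𝕜] F}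
    (hX : hsNormSq b X ≠ ∞) (hY : hsNormSq b Y ≠ ∞) :
    ∑' i, RCLike.re (inner 𝕜 (X (b i)) (Y (b i))) =
      ((hsNormSq b (X + Y)).toReal - (hsNormSq b (X - Y)).toReal) / 4 := by
  have hne : hsNormSq b (X + Y) + hsNormSq b (X - Y) ≠ ∞ := by
    rw [hsNormSq_add_add_hsNormSq_sub]
    finiteness
  have hadd := hasSum_norm_sq_hsNormSq (ENNReal.add_ne_top.1 hne).1
  have hsub := hasSum_norm_sq_hsNormSq (ENNReal.add_ne_top.1 hne).2
  rw [← ((hadd.sub hsub).div_const 4).tsum_eq]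
  refine tsum_congr fun i => ?_
  rw [re_inner_eq_norm_add_mul_self_sub_norm_sub_mul_self_div_four, add_apply, sub_apply,
    pow_two, pow_two]

theorem tsum_re_inner_adjoint [CompleteSpace E] [CompleteSpace F] {b : HilbertBasis ι 𝕜 E}
    (c : HilbertBasis κ 𝕜 F) {X Y : E →L[𝕜] F} (hX : hsNormSq b X ≠ ∞)
    (hY : hsNormSq b Y ≠ ∞) :
    ∑' j, RCLike.re (inner 𝕜 (adjoint X (c j)) (adjoint Y (c j))) =
      ∑' i, RCLike.re (inner 𝕜 (X (b i)) (Y (b i))) := by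
  rw [tsum_re_inner_eq_hsNormSq hX hY,
    tsum_re_inner_eq_hsNormSq (by rwa [hsNormSq_adjoint b]) (by rwa [hsNormSq_adjoint b]),
    ← map_add, ← map_sub, hsNormSq_adjoint b, hsNormSq_adjoint b]

end HilbertSchmidt

/-! ### The trace norm -/

section Factorization

variable {𝕜 E F G : Type*} [RCLike 𝕜] [NormedAddCommGroup E] [InnerProductSpace 𝕜 E]
  [NormedAddCommGroup F] [InnerProductSpace 𝕜 F] [CompleteSpace F]
  [NormedAddCommGroup G] [NormedSpace 𝕜 G] [CompleteSpace G]

theorem exists_contraction_factor {T : E →L[𝕜] G} {S : E →L[𝕜] F} (h : ∀ x, ‖T x‖ ≤ ‖S x‖) :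
    ∃ U : F →L[𝕜] G, ‖U‖ ≤ 1 ∧ T = U ∘L S := by
  let K : Submodule 𝕜 F := (LinearMap.range (S : E →ₗ[𝕜] F)).topologicalClosure
  have hmem : ∀ x, S x ∈ K := fun x => Submodule.le_topologicalClosure _ ⟨x, rfl⟩
  let e : E →ₗ[𝕜] K := (S : E →ₗ[𝕜] F).codRestrict K hmem
  have hdense : DenseRange e := by
    intro y
    rw [Metric.mem_closure_iff]
    intro ε hε
    obtain ⟨_, ⟨x, rfl⟩, hx⟩ := Metric.mem_closure_iff.1 y.2 ε hε
    exact ⟨e x, ⟨x, rfl⟩, hx⟩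
  have hbound : ∀ x, ‖(T : E →ₗ[𝕜] G) x‖ ≤ 1 * ‖e x‖ := fun x => (h x).trans (one_mul _).ge
  have : CompleteSpace K := (Submodule.isClosed_topologicalClosure _).completeSpace_coe
  refine ⟨((T : E →ₗ[𝕜] G).extendOfNorm e) ∘L K.orthogonalProjectionOnto, ?_, ?_⟩
  · refine (opNorm_comp_le _ _).trans (mul_le_one₀ ?_ (norm_nonneg _)
      (Submodule.orthogonalProjectionOnto_norm_le K))
    exact LinearMap.opNorm_extendOfNorm_le hdense zero_le_one hbound
  · ext x
    have hproj : K.orthogonalProjectionOnto (S x) = e x :=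
      Submodule.orthogonalProjectionOnto_mem_subspace_eq_self (e x)
    rw [comp_apply, comp_apply, hproj, LinearMap.extendOfNorm_eq hdense ⟨1, hbound⟩ x, coe_coe]

end Factorization

section TraceNorm

variable {H : Type*} [NormedAddCommGroup H] [InnerProductSpace ℂ H] [CompleteSpace H]

variable (H) in
/-- The Hilbert basis in which `posTrace` is computed. -/
def traceBasis : HilbertBasis (exists_hilbertBasis ℂ H).choose ℂ H :=
  (exists_hilbertBasis ℂ H).choose_spec.choose

theorem posTrace_eq_tsum (T : H →L[ℂ] H) : posTrace T =
    ∑' i, ENNReal.ofReal (RCLike.re (inner ℂ (traceBasis H i) (T (traceBasis H i)))) := rfl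

theorem posTrace_adjoint_comp_self (X : H →L[ℂ] H) :
    posTrace (adjoint X ∘L X) = hsNormSq (traceBasis H) X := by
  refine tsum_congr fun i => ?_
  rw [comp_apply, adjoint_inner_right, inner_self_eq_norm_sq, ENNReal.ofReal_pow (norm_nonneg _),
    ofReal_norm]
  rfl

theorem posTrace_add {S T : H →L[ℂ] H} (hS : 0 ≤ S) (hT : 0 ≤ T) :
    posTrace (S + T) = posTrace S + posTrace T := by
  have hre {R : H →L[ℂ] H} (hR : 0 ≤ R) (x : H) : 0 ≤ RCLike.re (inner ℂ x (R x)) :=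
    ((nonneg_iff_isPositive R).1 hR).re_inner_nonneg_right x
  simp only [posTrace_eq_tsum]
  rw [← ENNReal.tsum_add]
  refine tsum_congr fun i => ?_
  rw [← ENNReal.ofReal_add (hre hS _) (hre hT _), add_apply, inner_add_right, map_add]

theorem posTrace_le_besselNorm (T : H →L[ℂ] H) : posTrace T ≤ besselNorm T := by
  refine le_trans (ENNReal.tsum_le_tsum fun i => ?_)
    (tsum_enorm_inner_le_besselNorm T (traceBasis H).orthonormal)
  rw [← ofReal_norm]
  exact ENNReal.ofReal_le_ofReal (RCLike.re_le_norm _)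

theorem adjoint_sqrt (R : H →L[ℂ] H) : adjoint (CFC.sqrt R) = CFC.sqrt R :=
  (CFC.sqrt_nonneg R).isSelfAdjoint.adjoint_eq

theorem sqrt_comp_sqrt {R : H →L[ℂ] H} (hR : 0 ≤ R) : CFC.sqrt R ∘L CFC.sqrt R = R :=
  CFC.sqrt_mul_sqrt_self R hR

theorem posTrace_eq_hsNormSq_sqrt {R : H →L[ℂ] H} (hR : 0 ≤ R) :
    posTrace R = hsNormSq (traceBasis H) (CFC.sqrt R) := by
  rw [← posTrace_adjoint_comp_self, adjoint_sqrt, sqrt_comp_sqrt hR]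

theorem posTrace_eq_besselNorm {R : H →L[ℂ] H} (hR : 0 ≤ R) : posTrace R = besselNorm R := by
  refine (posTrace_le_besselNorm R).antisymm ?_
  calc besselNorm R = besselNorm (CFC.sqrt R ∘L CFC.sqrt R) := by rw [sqrt_comp_sqrt hR]
    _ ≤ posTrace R ^ (1 / 2 : ℝ) * posTrace R ^ (1 / 2 : ℝ) := by
        rw [posTrace_eq_hsNormSq_sqrt hR]
        exact besselNorm_comp_le_hsNormSq _ _ _ _
    _ = posTrace R := by
        rw [← ENNReal.rpow_add_of_nonneg _ _ (by norm_num) (by norm_num)]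
        norm_num

theorem norm_abs_apply (T : H →L[ℂ] H) (x : H) : ‖CFC.abs T x‖ = ‖T x‖ := by
  have habs : adjoint (CFC.abs T) ∘L CFC.abs T = adjoint T ∘L T := by
    rw [(CFC.abs_nonneg T).isSelfAdjoint.adjoint_eq]
    exact CFC.abs_mul_abs T
  rw [apply_norm_eq_sqrt_inner_adjoint_left, habs, ← apply_norm_eq_sqrt_inner_adjoint_left]

theorem exists_eq_comp_abs (T : H →L[ℂ] H) :
    ∃ U : H →L[ℂ] H, ‖U‖ ≤ 1 ∧ T = U ∘L CFC.abs T :=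
  exists_contraction_factor fun x => (norm_abs_apply T x).ge

theorem exists_abs_eq_comp (T : H →L[ℂ] H) :
    ∃ U : H →L[ℂ] H, ‖U‖ ≤ 1 ∧ CFC.abs T = U ∘L T :=
  exists_contraction_factor fun x => (norm_abs_apply T x).le

theorem traceNorm_eq_besselNorm (T : H →L[ℂ] H) : traceNorm T = besselNorm T := by
  rw [traceNorm, posTrace_eq_besselNorm (CFC.abs_nonneg T)]
  obtain ⟨U, hU, hT⟩ := exists_eq_comp_abs T
  obtain ⟨V, hV, habs⟩ := exists_abs_eq_comp T
  refine le_antisymm ?_ ?_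
  · rw [habs]
    exact besselNorm_contraction_comp_le hV T
  · conv_lhs => rw [hT]
    exact besselNorm_contraction_comp_le hU _

theorem traceNorm_eq_posTrace {R : H →L[ℂ] H} (hR : 0 ≤ R) : traceNorm R = posTrace R := by
  rw [traceNorm, CFC.abs_of_nonneg R hR]

theorem traceNorm_add_le (S T : H →L[ℂ] H) : traceNorm (S + T) ≤ traceNorm S + traceNorm T := by
  simpa only [traceNorm_eq_besselNorm] using besselNorm_add_le S T

theorem traceNorm_smul_le (c : ℂ) (T : H →L[ℂ] H) : traceNorm (c • T) ≤ ‖c‖ₑ * traceNorm T := by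
  simpa only [traceNorm_eq_besselNorm] using besselNorm_smul_le c T

theorem traceNorm_sub_le (S T : H →L[ℂ] H) : traceNorm (S - T) ≤ traceNorm S + traceNorm T := by
  have hneg : traceNorm ((-1 : ℂ) • T) ≤ traceNorm T :=
    (traceNorm_smul_le (-1) T).trans_eq (by rw [enorm_neg, enorm_one, one_mul])
  rw [sub_eq_add_neg, ← neg_one_smul ℂ T]
  exact (traceNorm_add_le _ _).trans (by gcongr)

theorem enorm_le_traceNorm (T : H →L[ℂ] H) : ‖T‖ₑ ≤ traceNorm T :=
  (enorm_le_besselNorm T).trans_eq (traceNorm_eq_besselNorm T).symm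

theorem traceNorm_adjoint (T : H →L[ℂ] H) : traceNorm (adjoint T) = traceNorm T := by
  simp only [traceNorm_eq_besselNorm, besselNorm_adjoint]

theorem traceNorm_contraction_comp_le {U : H →L[ℂ] H} (hU : ‖U‖ ≤ 1) (T : H →L[ℂ] H) :
    traceNorm (U ∘L T) ≤ traceNorm T := by
  simpa only [traceNorm_eq_besselNorm] using besselNorm_contraction_comp_le hU T

theorem traceNorm_comp_contraction_le {U : H →L[ℂ] H} (hU : ‖U‖ ≤ 1) (T : H →L[ℂ] H) :
    traceNorm (T ∘L U) ≤ traceNorm T := by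
  simpa only [traceNorm_eq_besselNorm] using besselNorm_comp_contraction_le hU T

variable {κ : Type*} {l : Filter κ}

theorem traceNorm_le_of_tendsto [l.NeBot] {T : κ → H →L[ℂ] H} {S : H →L[ℂ] H} {C : ℝ≥0∞}
    (hT : ∀ x, Tendsto (fun k => T k x) l (𝓝 (S x))) (hC : ∀ᶠ k in l, traceNorm (T k) ≤ C) :
    traceNorm S ≤ C := by
  simp only [traceNorm_eq_besselNorm] at hC ⊢
  exact besselNorm_le_of_tendsto hT hC

theorem tendsto_traceNorm_comp [l.IsCountablyGenerated] {Q : κ → H →L[ℂ] H} {C : ℝ}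
    (hQ : ∀ᶠ k in l, ‖Q k‖ ≤ C) (hQ0 : ∀ x, Tendsto (fun k => Q k x) l (𝓝 0)) {T : H →L[ℂ] H}
    (hT : traceNorm T ≠ ∞) : Tendsto (fun k => traceNorm (Q k ∘L T)) l (𝓝 0) := by
  obtain ⟨U, -, hUT⟩ := exists_eq_comp_abs T
  let b := traceBasis H
  let S := CFC.sqrt (CFC.abs T)
  have hS : hsNormSq b S ≠ ∞ := by
    rwa [← posTrace_eq_hsNormSq_sqrt (CFC.abs_nonneg T)]
  have hUS : hsNormSq b (U ∘L S) ≠ ∞ :=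
    ((hsNormSq_comp_le b U S).trans_lt (by finiteness)).ne
  have hfactor : T = (U ∘L S) ∘L S := by
    rw [comp_assoc, sqrt_comp_sqrt (CFC.abs_nonneg T), ← hUT]
  have hlim : Tendsto (fun k => hsNormSq b (Q k ∘L U ∘L S) ^ (1 / 2 : ℝ) *
      hsNormSq b S ^ (1 / 2 : ℝ)) l (𝓝 (0 ^ (1 / 2 : ℝ) * hsNormSq b S ^ (1 / 2 : ℝ))) :=
    ENNReal.Tendsto.mul_const ((tendsto_hsNormSq_comp hQ hQ0 b hUS).ennrpow_const _)
      (.inr (by finiteness))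
  rw [ENNReal.zero_rpow_of_pos one_half_pos, zero_mul] at hlim
  refine tendsto_of_tendsto_of_tendsto_of_le_of_le tendsto_const_nhds hlim (fun _ => zero_le)
    fun k => ?_
  simp only [traceNorm_eq_besselNorm]
  rw [hfactor, ← comp_assoc]
  exact besselNorm_comp_le_hsNormSq b b _ _

theorem tendsto_traceNorm_sub_compression [l.IsCountablyGenerated] {P : κ → H →L[ℂ] H}
    (hP : ∀ k, ‖P k‖ ≤ 1) (hsa : ∀ k, IsSelfAdjoint (P k))
    (hP1 : ∀ x, Tendsto (fun k => P k x) l (𝓝 x)) {T : H →L[ℂ] H} (hT : traceNorm T ≠ ∞) :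
    Tendsto (fun k => traceNorm (T - P k ∘L T ∘L P k)) l (𝓝 0) := by
  have hone : ‖(1 : H →L[ℂ] H)‖ ≤ 1 := norm_id_le
  have hQ : ∀ k, ‖1 - P k‖ ≤ 2 := fun k => (norm_sub_le _ _).trans (by linarith [hP k])
  have hQ0 : ∀ x, Tendsto (fun k => (1 - P k) x) l (𝓝 0) := fun x => by
    simpa using (tendsto_const_nhds (x := x)).sub (hP1 x)
  have hleft := tendsto_traceNorm_comp (.of_forall hQ) hQ0 hT
  have hright := tendsto_traceNorm_comp (.of_forall hQ) hQ0 (T := adjoint T)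
    (by rwa [traceNorm_adjoint])
  refine tendsto_of_tendsto_of_tendsto_of_le_of_le tendsto_const_nhds
    ((hleft.add hright).trans_eq (by rw [add_zero])) (fun _ => zero_le) fun k => ?_
  have hsplit : T - P k ∘L T ∘L P k =
      (1 - P k) ∘L T + P k ∘L adjoint ((1 - P k) ∘L adjoint T) := by
    rw [adjoint_comp, map_sub, (hsa k).adjoint_eq, adjoint_adjoint, adjoint_one]
    ext x
    simp
  calc traceNorm (T - P k ∘L T ∘L P k)
      ≤ traceNorm ((1 - P k) ∘L T) + traceNorm (P k ∘L adjoint ((1 - P k) ∘L adjoint T)) :=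
        hsplit ▸ traceNorm_add_le _ _
    _ ≤ traceNorm ((1 - P k) ∘L T) + traceNorm ((1 - P k) ∘L adjoint T) := by
        gcongr
        exact (traceNorm_contraction_comp_le (hP k) _).trans_eq (traceNorm_adjoint _)

/-- With `S = √R`, the Hilbert–Schmidt inner product gives
`‖A R A‖₁ = ⟪A S, A S⟫ = ⟪S, A² S⟫ = Tr (R A²)`. -/
theorem traceNorm_conj_le_of_nonneg {R A : H →L[ℂ] H} (hR : 0 ≤ R) (hA : IsSelfAdjoint A)
    (hRt : traceNorm R ≠ ∞) : traceNorm (A ∘L R ∘L A) ≤ traceNorm (R ∘L A ∘L A) := by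
  let b := traceBasis H
  let S := CFC.sqrt R
  have hSS : S ∘L S = R := sqrt_comp_sqrt hR
  have hSa : adjoint S = S := adjoint_sqrt R
  have hS : hsNormSq b S ≠ ∞ := by
    rwa [← posTrace_eq_hsNormSq_sqrt hR, ← traceNorm_eq_posTrace hR]
  have hAS : hsNormSq b (A ∘L S) ≠ ∞ := ((hsNormSq_comp_le b A S).trans_lt (by finiteness)).ne
  have hAAS : hsNormSq b (A ∘L A ∘L S) ≠ ∞ :=
    ((hsNormSq_comp_le b A _).trans_lt (by finiteness)).ne
  have hpos : 0 ≤ A ∘L R ∘L A := hA.conjugate_nonneg hR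
  calc traceNorm (A ∘L R ∘L A) = hsNormSq b (A ∘L S) := by
        rw [traceNorm_eq_posTrace hpos, ← hsNormSq_adjoint b b, adjoint_comp,
          hSa, hA.adjoint_eq, ← posTrace_adjoint_comp_self, adjoint_comp, hSa, hA.adjoint_eq,
          comp_assoc, ← comp_assoc S S, hSS]
    _ = ENNReal.ofReal (∑' i, RCLike.re (inner ℂ (S (b i)) ((A ∘L A ∘L S) (b i)))) := by
        rw [← ENNReal.ofReal_toReal hAS, ← (hasSum_norm_sq_hsNormSq hAS).tsum_eq]
        congr! 3 with i
        rw [comp_apply, comp_apply, comp_apply, ← adjoint_inner_left A, hA.adjoint_eq,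
          inner_self_eq_norm_sq]
    _ = ENNReal.ofReal (∑' i, RCLike.re (inner ℂ (b i) ((R ∘L A ∘L A) (b i)))) := by
        rw [← tsum_re_inner_adjoint b hS hAAS, adjoint_comp, adjoint_comp, hA.adjoint_eq, hSa]
        simp only [← hSS, comp_apply, ← adjoint_inner_left S, hSa]
    _ ≤ ∑' i, ‖inner ℂ (b i) ((R ∘L A ∘L A) (b i))‖ₑ := by
        refine Real.ofReal_le_enorm _ |>.trans <| enorm_tsum_le_tsum_enorm.trans <|
          ENNReal.tsum_le_tsum fun i => enorm_le_iff_norm_le.2 ?_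
        exact RCLike.abs_re_le_norm _
    _ ≤ traceNorm (R ∘L A ∘L A) :=
        traceNorm_eq_besselNorm (R ∘L A ∘L A) ▸ tsum_enorm_inner_le_besselNorm _ b.orthonormal

theorem traceNorm_conj_le {ρ A : H →L[ℂ] H} (hρ : IsSelfAdjoint ρ) (hA : IsSelfAdjoint A)
    (hρt : traceNorm ρ ≠ ∞) : traceNorm (A ∘L ρ ∘L A) ≤ traceNorm (A ∘L A ∘L ρ) := by
  have hpos := hA.conjugate_nonneg (CFC.posPart_nonneg ρ)
  have hneg := hA.conjugate_nonneg (CFC.negPart_nonneg ρ)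
  obtain ⟨V, hV, habs⟩ := exists_abs_eq_comp ρ
  calc traceNorm (A ∘L ρ ∘L A)
      = traceNorm (A * ρ⁺ * A - A * ρ⁻ * A) := by
        rw [← sub_mul, ← mul_sub, CFC.posPart_sub_negPart ρ hρ]
        rfl
    _ ≤ traceNorm (A * ρ⁺ * A) + traceNorm (A * ρ⁻ * A) := traceNorm_sub_le _ _
    _ = traceNorm (A ∘L CFC.abs ρ ∘L A) := by
        rw [traceNorm_eq_posTrace hpos, traceNorm_eq_posTrace hneg, ← posTrace_add hpos hneg,
          ← add_mul, ← mul_add, CFC.posPart_add_negPart ρ hρ]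
        exact (traceNorm_eq_posTrace (hA.conjugate_nonneg (CFC.abs_nonneg ρ))).symm
    _ ≤ traceNorm (CFC.abs ρ ∘L A ∘L A) := by
        refine traceNorm_conj_le_of_nonneg (CFC.abs_nonneg ρ) hA ?_
        rwa [traceNorm, CFC.abs_of_nonneg _ (CFC.abs_nonneg ρ)]
    _ ≤ traceNorm (ρ ∘L A ∘L A) := by
        rw [habs, comp_assoc]
        exact traceNorm_contraction_comp_le hV _
    _ = traceNorm (A ∘L A ∘L ρ) := by
        rw [← traceNorm_adjoint, adjoint_comp, adjoint_comp, hρ.adjoint_eq, hA.adjoint_eq,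
          comp_assoc]

end TraceNorm

/-! ### Banach spaces cut out by an extended norm -/

section DominatingNorm

/-- An extended norm that dominates the norm of the ambient space and is lower semicontinuous for
it. Its finite elements then form a Banach space. -/
structure IsDominatingNorm {V : Type*} [NormedAddCommGroup V] [NormedSpace ℝ V]
    (N : V → ℝ≥0∞) : Prop where
  add_le : ∀ x y, N (x + y) ≤ N x + N y
  smul_le : ∀ (c : ℝ) x, N (c • x) ≤ ‖c‖ₑ * N x
  enorm_le : ∀ x, ‖x‖ₑ ≤ N x
  lowerSemicontinuous : LowerSemicontinuous N

namespace IsDominatingNorm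

variable {V : Type u} [NormedAddCommGroup V] [NormedSpace ℝ V] {N : V → ℝ≥0∞}

theorem map_zero (hN : IsDominatingNorm N) : N 0 = 0 := by
  simpa using hN.smul_le 0 0

theorem map_neg (hN : IsDominatingNorm N) (x : V) : N (-x) = N x := by
  have hle : ∀ x, N (-x) ≤ N x := fun x => by simpa using hN.smul_le (-1) x
  exact (hle x).antisymm (by simpa using hle (-x))

theorem le_of_tendsto (hN : IsDominatingNorm N) {v : ℕ → V} {x : V} {C : ℝ≥0∞}
    (hv : Tendsto v atTop (𝓝 x)) (hC : ∀ᶠ n in atTop, N (v n) ≤ C) : N x ≤ C :=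
  (hN.lowerSemicontinuous.isClosed_preimage C).mem_of_tendsto hv hC

variable (N) in
/-- The elements of finite extended norm. -/
def finiteSubmodule (hN : IsDominatingNorm N) : Submodule ℝ V where
  carrier := {x | N x < ∞}
  zero_mem' := by simp [hN.map_zero]
  add_mem' {x y} hx hy := (hN.add_le x y).trans_lt (ENNReal.add_lt_top.2 ⟨hx, hy⟩)
  smul_mem' c x hx := (hN.smul_le c x).trans_lt (ENNReal.mul_lt_top enorm_lt_top hx)

/-- A copy of `finiteSubmodule`, carrying the norm `N` instead of the induced norm. -/
def FiniteSpace (hN : IsDominatingNorm N) : Type u := finiteSubmodule N hN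

namespace FiniteSpace

variable {hN : IsDominatingNorm N}

instance : AddCommGroup (FiniteSpace hN) := inferInstanceAs (AddCommGroup (finiteSubmodule N hN))

instance : Module ℝ (FiniteSpace hN) := inferInstanceAs (Module ℝ (finiteSubmodule N hN))

variable (hN) in
/-- The inclusion of the finite elements into the ambient space. -/
def incl : FiniteSpace hN →ₗ[ℝ] V := (finiteSubmodule N hN).subtype

theorem incl_injective : Function.Injective (incl hN) := Subtype.val_injective

theorem range_incl : Set.range (incl hN) = {x | N x < ∞} := Subtype.range_coe

theorem ofReal_toReal_incl (x : FiniteSpace hN) :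
    ENNReal.ofReal (N (incl hN x)).toReal = N (incl hN x) :=
  ENNReal.ofReal_toReal (Subtype.property x).ne

theorem toReal_incl_le_iff {x : FiniteSpace hN} {C : ℝ} (hC : 0 ≤ C) :
    (N (incl hN x)).toReal ≤ C ↔ N (incl hN x) ≤ ENNReal.ofReal C := by
  rw [← ENNReal.ofReal_le_ofReal_iff hC, ofReal_toReal_incl]

theorem norm_incl_le_toReal (x : FiniteSpace hN) : ‖incl hN x‖ ≤ (N (incl hN x)).toReal := by
  rw [← ENNReal.ofReal_le_ofReal_iff ENNReal.toReal_nonneg, ofReal_toReal_incl, ofReal_norm]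
  exact hN.enorm_le _

instance : NormedAddCommGroup (FiniteSpace hN) :=
  AddGroupNorm.toNormedAddCommGroup
    { toFun := fun x => (N (incl hN x)).toReal
      map_zero' := by simp [hN.map_zero]
      add_le' := fun x y => by
        rw [toReal_incl_le_iff (by positivity), ENNReal.ofReal_add (by positivity) (by positivity),
          ofReal_toReal_incl, ofReal_toReal_incl, map_add]
        exact hN.add_le _ _
      neg' := fun x => by rw [LinearMap.map_neg, hN.map_neg]
      eq_zero_of_map_eq_zero' := fun x hx => incl_injective <| by
        rw [norm_le_zero_iff.1 ((norm_incl_le_toReal x).trans_eq hx), LinearMap.map_zero] }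

theorem norm_def (x : FiniteSpace hN) : ‖x‖ = (N (incl hN x)).toReal := rfl

theorem norm_le_iff {x : FiniteSpace hN} {C : ℝ} (hC : 0 ≤ C) :
    ‖x‖ ≤ C ↔ N (incl hN x) ≤ ENNReal.ofReal C :=
  toReal_incl_le_iff hC

instance : NormedSpace ℝ (FiniteSpace hN) where
  norm_smul_le c x := by
    rw [norm_le_iff (by positivity), ENNReal.ofReal_mul (norm_nonneg c), norm_def x,
      ofReal_toReal_incl, ofReal_norm, map_smul]
    exact hN.smul_le c _

instance [CompleteSpace V] : CompleteSpace (FiniteSpace hN) := by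
  refine Metric.complete_of_cauchySeq_tendsto fun v hv => ?_
  have hincl : UniformContinuous (incl hN) :=
    AddMonoidHomClass.uniformContinuous_of_bound (incl hN) 1 fun x =>
      (norm_incl_le_toReal x).trans_eq (one_mul _).symm
  obtain ⟨x, hx⟩ := cauchySeq_tendsto_of_complete (hincl.comp_cauchySeq hv)
  have htail : ∀ ε > 0, ∃ n₀, ∀ n ≥ n₀, N (incl hN (v n) - x) ≤ ENNReal.ofReal ε := by
    intro ε hε
    obtain ⟨n₀, hn₀⟩ := Metric.cauchySeq_iff.1 hv ε hε
    refine ⟨n₀, fun n hn => hN.le_of_tendsto (hx.const_sub (incl hN (v n)))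
      ((eventually_ge_atTop n₀).mono fun m hm => ?_)⟩
    rw [Function.comp_apply, ← map_sub, ← norm_le_iff hε.le, ← dist_eq_norm]
    exact (hn₀ n hn m hm).le
  have hxN : N x < ∞ := by
    obtain ⟨n₀, hn₀⟩ := htail 1 one_pos
    have hdiff : N (x - incl hN (v n₀)) < ∞ := by
      rw [← neg_sub, hN.map_neg]
      exact (hn₀ n₀ le_rfl).trans_lt ENNReal.ofReal_lt_top
    rw [← sub_add_cancel x (incl hN (v n₀))]
    exact (hN.add_le _ _).trans_lt (ENNReal.add_lt_top.2 ⟨hdiff, Subtype.property (v n₀)⟩)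
  obtain ⟨y, rfl⟩ : x ∈ Set.range (incl hN) := by rwa [range_incl]
  refine ⟨y, Metric.tendsto_atTop'.2 fun ε hε => ?_⟩
  obtain ⟨n₀, hn₀⟩ := htail (ε / 2) (half_pos hε)
  refine ⟨n₀, fun n hn => lt_of_le_of_lt ?_ (half_lt_self hε)⟩
  rw [dist_eq_norm, norm_le_iff (half_pos hε).le, map_sub]
  exact hn₀ n hn.le

end FiniteSpace

theorem isRealBanachSpace_image [CompleteSpace V] (hN : IsDominatingNorm N) {W : Type u}
    [AddCommGroup W] [Module ℝ W] {φ : V →ₗ[ℝ] W} (hφ : Function.Injective φ) {M : W → ℝ}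
    (hM : ∀ x, M (φ x) = (N x).toReal) : IsRealBanachSpace (φ '' {x | N x < ∞}) M :=
  ⟨FiniteSpace hN, inferInstance, inferInstance, φ ∘ₗ FiniteSpace.incl hN, inferInstance,
    hφ.comp FiniteSpace.incl_injective,
    by rw [LinearMap.coe_comp, Set.range_comp, FiniteSpace.range_incl], fun _ => (hM _).symm⟩

theorem fst_add_snd_comp_subtype {W : Type*} [NormedAddCommGroup W] [NormedSpace ℝ W]
    {M : W → ℝ≥0∞} (hN : IsDominatingNorm N) (hM : IsDominatingNorm M)
    (K : Submodule ℝ (V × W)) : IsDominatingNorm fun p : K => N p.1.1 + M p.1.2 where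
  add_le _ _ := (add_le_add (hN.add_le _ _) (hM.add_le _ _)).trans_eq (add_add_add_comm _ _ _ _)
  smul_le c _ := (add_le_add (hN.smul_le c _) (hM.smul_le c _)).trans_eq (mul_add _ _ _).symm
  enorm_le _ := max_le ((hN.enorm_le _).trans le_self_add) ((hM.enorm_le _).trans le_add_self)
  lowerSemicontinuous :=
    (hN.lowerSemicontinuous.comp (continuous_fst.comp continuous_subtype_val)).add
      (hM.lowerSemicontinuous.comp (continuous_snd.comp continuous_subtype_val))

/-- The finite part of a closed single-valued relation `K` is the graph of a linear map, and the
graph norm makes its domain a Banach space. -/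
theorem isRealBanachSpace_of_isClosed_graph [CompleteSpace V] {W : Type u} [NormedAddCommGroup W]
    [NormedSpace ℝ W] [CompleteSpace W] {M : W → ℝ≥0∞} (hN : IsDominatingNorm N)
    (hM : IsDominatingNorm M) {K : Submodule ℝ (V × W)} (hK : IsClosed (K : Set (V × W)))
    (hKinj : ∀ y, (0, y) ∈ K → y = 0) {S : Set V} {ν : V → ℝ}
    (hS : ∀ x, x ∈ S ↔ ∃ y, (x, y) ∈ K ∧ N x < ∞ ∧ M y < ∞)
    (hν : ∀ x y, (x, y) ∈ K → ν x = (N x + M y).toReal) : IsRealBanachSpace S ν := by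
  have : CompleteSpace K := hK.completeSpace_coe
  let φ : K →ₗ[ℝ] V := LinearMap.fst ℝ V W ∘ₗ K.subtype
  have hφ : Function.Injective φ := by
    refine (injective_iff_map_eq_zero φ).2 ?_
    rintro ⟨⟨x, y⟩, hxy⟩ (rfl : x = 0)
    obtain rfl := hKinj y hxy
    rfl
  have himage : S = φ '' {p | N p.1.1 + M p.1.2 < ∞} := by
    ext x
    rw [hS]
    constructor
    · rintro ⟨y, hxy, hx, hy⟩
      exact ⟨⟨(x, y), hxy⟩, ENNReal.add_lt_top.2 ⟨hx, hy⟩, rfl⟩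
    · rintro ⟨p, hp, rfl⟩
      exact ⟨p.1.2, p.2, ENNReal.add_lt_top.1 hp⟩
  rw [himage]
  exact (hN.fst_add_snd_comp_subtype hM K).isRealBanachSpace_image hφ fun p => hν _ _ p.2

end IsDominatingNorm

end DominatingNorm

/-! ### Partially defined products -/

section PartialMaps

variable {H : Type*} [NormedAddCommGroup H] [InnerProductSpace ℂ H]

theorem mem_graph_toPMap_top_iff {γ : H →L[ℂ] H} {x y : H} :
    (x, y) ∈ ((γ : H →ₗ[ℂ] H).toPMap ⊤).graph ↔ γ x = y := by
  rw [LinearPMap.mem_graph_iff]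
  exact ⟨fun ⟨_, hz, hy⟩ => (congrArg γ hz).symm.trans hy, fun h => ⟨⟨x, trivial⟩, rfl, h⟩⟩

theorem mem_graph_compPMap_iff {ρ : H →L[ℂ] H} {T : H →ₗ.[ℂ] H} {x z : H} :
    (x, z) ∈ ((ρ : H →ₗ[ℂ] H).compPMap T).graph ↔ ∃ y, (x, y) ∈ T.graph ∧ ρ y = z := by
  simp only [LinearPMap.mem_graph_iff]
  exact ⟨fun ⟨w, hx, hz⟩ => ⟨T w, ⟨w, hx, rfl⟩, hz⟩,
    fun ⟨y, ⟨w, hx, hy⟩, hz⟩ => ⟨w, hx, (congrArg ρ hy).trans hz⟩⟩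

theorem mem_graph_pcomp_iff {S T : H →ₗ.[ℂ] H} {x z : H} :
    (x, z) ∈ (pcomp S T).graph ↔ ∃ y, (x, y) ∈ T.graph ∧ (y, z) ∈ S.graph := by
  simp only [LinearPMap.mem_graph_iff]
  constructor
  · rintro ⟨⟨w, hw, hw'⟩, hx, hz⟩
    obtain ⟨v, hv, rfl⟩ := hw
    exact ⟨T v, ⟨v, hx, rfl⟩, ⟨T v, hv⟩, rfl, hz⟩
  · rintro ⟨y, ⟨v, hx, hy⟩, ⟨u, huy, hz⟩⟩
    have hTv : T v = u := hy.trans huy.symm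
    have hv : T v ∈ S.domain := hTv ▸ u.2
    have hu : (⟨T v, hv⟩ : S.domain) = u := Subtype.ext hTv
    exact ⟨⟨v, ⟨v, hv, rfl⟩, v.2⟩, hx, (congrArg S hu).trans hz⟩

theorem isClosed_toPMap_top (γ : H →L[ℂ] H) : ((γ : H →ₗ[ℂ] H).toPMap ⊤).IsClosed := by
  have hgraph : (((γ : H →ₗ[ℂ] H).toPMap ⊤).graph : Set (H × H)) = {p | γ p.1 = p.2} :=
    Set.ext fun _ => mem_graph_toPMap_top_iff
  rw [LinearPMap.IsClosed, hgraph]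
  exact isClosed_eq (by fun_prop) (by fun_prop)

theorem toPMap_top_injective {γ γ' : H →L[ℂ] H}
    (h : (γ : H →ₗ[ℂ] H).toPMap ⊤ = (γ' : H →ₗ[ℂ] H).toPMap ⊤) : γ = γ' := by
  ext x
  exact (mem_graph_toPMap_top_iff.1 (h ▸ mem_graph_toPMap_top_iff.2 rfl)).symm

variable [CompleteSpace H]

theorem pTraceNorm_toPMap_top (γ : H →L[ℂ] H) :
    pTraceNorm ((γ : H →ₗ[ℂ] H).toPMap ⊤) = traceNorm γ :=
  le_antisymm (iInf_le_of_le γ (iInf_le_of_le rfl le_rfl))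
    (le_iInf₂ fun _ h => (congrArg traceNorm (toPMap_top_injective h)).le)

theorem pTraceNorm_lt_top_iff {T : H →ₗ.[ℂ] H} : pTraceNorm T < ∞ ↔
    ∃ γ : H →L[ℂ] H, T = (γ : H →ₗ[ℂ] H).toPMap ⊤ ∧ traceNorm γ < ∞ := by
  simp only [pTraceNorm, iInf_lt_iff, exists_prop]

end PartialMaps

section Spaces

variable {H : Type*} [NormedAddCommGroup H] [InnerProductSpace ℂ H] {A T : H →ₗ.[ℂ] H}
  {ρ τ γ : H →L[ℂ] H}

/-- `A ρ A` on its natural domain; `sandwich ρ` is the case `A = H₀^{1/2}`. -/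
def sandwichProduct (A : H →ₗ.[ℂ] H) (ρ : H →L[ℂ] H) : H →ₗ.[ℂ] H :=
  pcomp A ((ρ : H →ₗ[ℂ] H).compPMap A)

/-- `T ρ` on its natural domain; `leftProd ρ` is the case `T = H₀`. -/
def leftProduct (T : H →ₗ.[ℂ] H) (ρ : H →L[ℂ] H) : H →ₗ.[ℂ] H :=
  pcomp T ((ρ : H →ₗ[ℂ] H).toPMap ⊤)

/-- `τ` is the bounded extension of `A ρ A`, and `A ρ A` is defined on the whole domain of `A`. -/
def IsSandwich (A : H →ₗ.[ℂ] H) (ρ τ : H →L[ℂ] H) : Prop :=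
  ∀ f g, (f, g) ∈ A.graph → (ρ g, τ f) ∈ A.graph

/-- `γ` is the everywhere defined product `T ρ`. -/
def IsLeftProduct (T : H →ₗ.[ℂ] H) (ρ γ : H →L[ℂ] H) : Prop :=
  ∀ f, (ρ f, γ f) ∈ T.graph

theorem mem_graph_sandwichProduct_iff {f h : H} : (f, h) ∈ (sandwichProduct A ρ).graph ↔
    ∃ g, (f, g) ∈ A.graph ∧ (ρ g, h) ∈ A.graph := by
  rw [sandwichProduct, mem_graph_pcomp_iff]
  simp_rw [mem_graph_compPMap_iff]
  exact ⟨fun ⟨_, ⟨g, hfg, hg⟩, h⟩ => ⟨g, hfg, hg ▸ h⟩, fun ⟨g, hfg, h⟩ => ⟨ρ g, ⟨g, hfg, rfl⟩, h⟩⟩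

theorem mem_graph_leftProduct_iff {f h : H} :
    (f, h) ∈ (leftProduct T ρ).graph ↔ (ρ f, h) ∈ T.graph := by
  rw [leftProduct, mem_graph_pcomp_iff]
  simp_rw [mem_graph_toPMap_top_iff]
  exact ⟨fun ⟨_, hy, h⟩ => hy ▸ h, fun h => ⟨ρ f, rfl, h⟩⟩

theorem eq_of_mem_graph {f g g' : H} (h : (f, g) ∈ A.graph) (h' : (f, g') ∈ A.graph) : g = g' :=
  A.mem_graph_snd_inj h h' rfl

theorem IsSandwich.domain_le (h : IsSandwich A ρ τ) : A.domain ≤ (sandwichProduct A ρ).domain := by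
  intro f hf
  obtain ⟨g, hfg⟩ := LinearPMap.mem_domain_iff.1 hf
  exact LinearPMap.mem_domain_iff.2 ⟨τ f, mem_graph_sandwichProduct_iff.2 ⟨g, hfg, h f g hfg⟩⟩

theorem IsSandwich.closure_eq (hA : Dense (A.domain : Set H)) (h : IsSandwich A ρ τ) :
    (sandwichProduct A ρ).closure = (τ : H →ₗ[ℂ] H).toPMap ⊤ := by
  have hle : sandwichProduct A ρ ≤ (τ : H →ₗ[ℂ] H).toPMap ⊤ := by
    refine LinearPMap.le_of_le_graph ?_
    rintro ⟨f, k⟩ hf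
    obtain ⟨g, hfg, hgk⟩ := mem_graph_sandwichProduct_iff.1 hf
    exact mem_graph_toPMap_top_iff.2 (eq_of_mem_graph (h f g hfg) hgk)
  have hclosed := isClosed_toPMap_top τ
  have hclosable : (sandwichProduct A ρ).IsClosable := hclosed.isClosable.leIsClosable hle
  refine LinearPMap.eq_of_eq_graph (le_antisymm ?_ ?_) <;>
    rw [← hclosable.graph_closure_eq_closure_graph]
  · exact Submodule.topologicalClosure_minimal _ (LinearPMap.le_graph_of_le hle) hclosed
  · rintro ⟨f, k⟩ hfk
    obtain rfl := mem_graph_toPMap_top_iff.1 hfk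
    refine map_mem_closure (f := fun x => (x, τ x)) (by fun_prop) (hA f) fun x hx => ?_
    obtain ⟨g, hxg⟩ := LinearPMap.mem_domain_iff.1 hx
    exact mem_graph_sandwichProduct_iff.2 ⟨g, hxg, h x g hxg⟩

theorem isSandwich_of_closure_eq (hdom : A.domain ≤ (sandwichProduct A ρ).domain)
    (h : (sandwichProduct A ρ).closure = (τ : H →ₗ[ℂ] H).toPMap ⊤) : IsSandwich A ρ τ := by
  intro f g hfg
  obtain ⟨k, hk⟩ := LinearPMap.mem_domain_iff.1 (hdom (LinearPMap.mem_domain_of_mem_graph hfg))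
  have hτ : τ f = k := mem_graph_toPMap_top_iff.1
    (h ▸ LinearPMap.le_graph_of_le (LinearPMap.le_closure _) hk)
  obtain ⟨g', hfg', hk'⟩ := mem_graph_sandwichProduct_iff.1 hk
  rwa [hτ, eq_of_mem_graph hfg hfg']

theorem isLeftProduct_iff :
    IsLeftProduct T ρ γ ↔ leftProduct T ρ = (γ : H →ₗ[ℂ] H).toPMap ⊤ := by
  constructor
  · refine fun h => LinearPMap.eq_of_eq_graph (SetLike.ext ?_)
    rintro ⟨f, k⟩
    rw [mem_graph_leftProduct_iff, mem_graph_toPMap_top_iff]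
    exact ⟨eq_of_mem_graph (h f), fun hk => hk ▸ h f⟩
  · intro h f
    rw [← mem_graph_leftProduct_iff, h, mem_graph_toPMap_top_iff]

variable [CompleteSpace H]

/-- The Hermitian trace class `ρ` for which `A ρ A` is defined on the domain of `A` and has a trace
class closure; `Z` is the case `A = H₀^{1/2}`. -/
def sandwichSpace (A : H →ₗ.[ℂ] H) : Set (H →L[ℂ] H) :=
  {ρ | IsSelfAdjoint ρ ∧ traceNorm ρ < ∞ ∧ A.domain ≤ (sandwichProduct A ρ).domain ∧
    pTraceNorm (sandwichProduct A ρ).closure < ∞}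

/-- The norm of `sandwichSpace A`; `normZ` is the case `A = H₀^{1/2}`. -/
def sandwichNorm (A : H →ₗ.[ℂ] H) (ρ : H →L[ℂ] H) : ℝ :=
  (traceNorm ρ + pTraceNorm (sandwichProduct A ρ).closure).toReal

/-- The Hermitian trace class `ρ` for which `T ρ` is trace class; `Y` is the case `T = H₀`. -/
def leftProductSpace (T : H →ₗ.[ℂ] H) : Set (H →L[ℂ] H) :=
  {ρ | IsSelfAdjoint ρ ∧ traceNorm ρ < ∞ ∧ pTraceNorm (leftProduct T ρ) < ∞}

/-- The norm of `leftProductSpace T`; `normY` is the case `T = H₀`. -/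
def leftProductNorm (T : H →ₗ.[ℂ] H) (ρ : H →L[ℂ] H) : ℝ :=
  (traceNorm ρ + pTraceNorm (leftProduct T ρ)).toReal

theorem mem_sandwichSpace_iff (hA : Dense (A.domain : Set H)) : ρ ∈ sandwichSpace A ↔
    ∃ τ, (IsSelfAdjoint ρ ∧ IsSandwich A ρ τ) ∧ traceNorm ρ < ∞ ∧ traceNorm τ < ∞ := by
  constructor
  · rintro ⟨hρ, hρt, hdom, hcl⟩
    obtain ⟨τ, hτ, hτt⟩ := pTraceNorm_lt_top_iff.1 hcl
    exact ⟨τ, ⟨hρ, isSandwich_of_closure_eq hdom hτ⟩, hρt, hτt⟩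
  · rintro ⟨τ, ⟨hρ, h⟩, hρt, hτt⟩
    exact ⟨hρ, hρt, h.domain_le, pTraceNorm_lt_top_iff.2 ⟨τ, h.closure_eq hA, hτt⟩⟩

theorem IsSandwich.sandwichNorm_eq (hA : Dense (A.domain : Set H)) (h : IsSandwich A ρ τ) :
    sandwichNorm A ρ = (traceNorm ρ + traceNorm τ).toReal := by
  rw [sandwichNorm, h.closure_eq hA, pTraceNorm_toPMap_top]

theorem mem_leftProductSpace_iff : ρ ∈ leftProductSpace T ↔
    ∃ γ, (IsSelfAdjoint ρ ∧ IsLeftProduct T ρ γ) ∧ traceNorm ρ < ∞ ∧ traceNorm γ < ∞ := by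
  simp only [leftProductSpace, Set.mem_ofPred_eq, pTraceNorm_lt_top_iff, isLeftProduct_iff]
  exact ⟨fun ⟨hρ, hρt, γ, hγ, hγt⟩ => ⟨γ, ⟨hρ, hγ⟩, hρt, hγt⟩,
    fun ⟨γ, ⟨hρ, hγ⟩, hρt, hγt⟩ => ⟨hρ, hρt, γ, hγ, hγt⟩⟩

theorem IsLeftProduct.leftProductNorm_eq (h : IsLeftProduct T ρ γ) :
    leftProductNorm T ρ = (traceNorm ρ + traceNorm γ).toReal := by
  rw [leftProductNorm, isLeftProduct_iff.1 h, pTraceNorm_toPMap_top]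

end Spaces

/-! ### Completeness -/

section Completeness

variable {H : Type u} [NormedAddCommGroup H] [InnerProductSpace ℂ H] [NormedSpace ℝ H]
  [IsScalarTower ℝ ℂ H] {A T : H →ₗ.[ℂ] H}

theorem real_smul_mem_graph {f g : H} (h : (f, g) ∈ T.graph) (c : ℝ) :
    (c • f, c • g) ∈ T.graph := by
  rw [← algebraMap_smul ℂ c f, ← algebraMap_smul ℂ c g]
  exact T.graph.smul_mem _ h

variable [CompleteSpace H]

theorem isDominatingNorm_traceNorm : IsDominatingNorm (traceNorm : (H →L[ℂ] H) → ℝ≥0∞) where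
  add_le := traceNorm_add_le
  smul_le c T := by
    rw [← algebraMap_smul ℂ c T]
    exact (traceNorm_smul_le _ T).trans_eq (by simp [enorm_eq_nnnorm])
  enorm_le := enorm_le_traceNorm
  lowerSemicontinuous := by
    refine lowerSemicontinuous_iff_isClosed_preimage.2 fun C =>
      isClosed_iff_forall_filter.2 fun T l _ hl hlT => ?_
    refine traceNorm_le_of_tendsto (T := id) (fun x => ?_) (le_principal_iff.1 hl)
    exact ((ContinuousLinearMap.apply ℂ H x).continuous.tendsto T).comp hlT

theorem isSelfAdjoint_real_smul {ρ : H →L[ℂ] H} (hρ : IsSelfAdjoint ρ) (c : ℝ) :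
    IsSelfAdjoint (c • ρ) := by
  rw [← algebraMap_smul ℂ c ρ]
  exact IsSelfAdjoint.smul (Complex.conj_ofReal c) hρ

/-- The pairs `(ρ, τ)` with `ρ` Hermitian and `τ` the bounded extension of `A ρ A`. -/
def sandwichGraph (A : H →ₗ.[ℂ] H) : Submodule ℝ ((H →L[ℂ] H) × (H →L[ℂ] H)) where
  carrier := {p | IsSelfAdjoint p.1 ∧ IsSandwich A p.1 p.2}
  zero_mem' := ⟨.zero _, fun _ _ _ => A.graph.zero_mem⟩
  add_mem' hp hq := ⟨hp.1.add hq.1, fun f g h => A.graph.add_mem (hp.2 f g h) (hq.2 f g h)⟩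
  smul_mem' c _ hp :=
    ⟨isSelfAdjoint_real_smul hp.1 c, fun f g h => real_smul_mem_graph (hp.2 f g h) c⟩

/-- The pairs `(ρ, γ)` with `ρ` Hermitian and `γ` the bounded product `T ρ`. -/
def leftProductGraph (T : H →ₗ.[ℂ] H) : Submodule ℝ ((H →L[ℂ] H) × (H →L[ℂ] H)) where
  carrier := {p | IsSelfAdjoint p.1 ∧ IsLeftProduct T p.1 p.2}
  zero_mem' := ⟨.zero _, fun _ => T.graph.zero_mem⟩
  add_mem' hp hq := ⟨hp.1.add hq.1, fun f => T.graph.add_mem (hp.2 f) (hq.2 f)⟩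
  smul_mem' c _ hp := ⟨isSelfAdjoint_real_smul hp.1 c, fun f => real_smul_mem_graph (hp.2 f) c⟩

theorem isClosed_sandwichGraph (hA : A.IsClosed) :
    IsClosed (sandwichGraph A : Set ((H →L[ℂ] H) × (H →L[ℂ] H))) := by
  have hsandwich : IsClosed {p : (H →L[ℂ] H) × (H →L[ℂ] H) | IsSandwich A p.1 p.2} := by
    simp only [IsSandwich, Set.ofPred_forall]
    exact isClosed_iInter fun f => isClosed_iInter fun g => isClosed_iInter fun _ =>
      hA.preimage (f := fun p : (H →L[ℂ] H) × (H →L[ℂ] H) => (p.1 g, p.2 f)) (by fun_prop)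
  exact ((isClosed_eq continuous_star continuous_id).preimage continuous_fst).inter hsandwich

theorem isClosed_leftProductGraph (hT : T.IsClosed) :
    IsClosed (leftProductGraph T : Set ((H →L[ℂ] H) × (H →L[ℂ] H))) := by
  have hproduct : IsClosed {p : (H →L[ℂ] H) × (H →L[ℂ] H) | IsLeftProduct T p.1 p.2} := by
    simp only [IsLeftProduct, Set.ofPred_forall]
    exact isClosed_iInter fun f =>
      hT.preimage (f := fun p : (H →L[ℂ] H) × (H →L[ℂ] H) => (p.1 f, p.2 f)) (by fun_prop)
  exact ((isClosed_eq continuous_star continuous_id).preimage continuous_fst).inter hproduct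

theorem isRealBanachSpace_sandwichSpace (hA : A.IsClosed) (hdense : Dense (A.domain : Set H)) :
    IsRealBanachSpace (sandwichSpace A) (sandwichNorm A) := by
  refine isDominatingNorm_traceNorm.isRealBanachSpace_of_isClosed_graph isDominatingNorm_traceNorm
    (isClosed_sandwichGraph hA) (fun τ hτ => ?_) (fun ρ => mem_sandwichSpace_iff hdense)
    fun ρ τ h => h.2.sandwichNorm_eq hdense
  refine ContinuousLinearMap.ext_on (s := (A.domain : Set H)) ?_ fun f hf => ?_
  · exact hdense.mono Submodule.subset_span
  · obtain ⟨g, hfg⟩ := LinearPMap.mem_domain_iff.1 hf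
    exact eq_of_mem_graph (hτ.2 f g hfg) A.graph.zero_mem

theorem isRealBanachSpace_leftProductSpace (hT : T.IsClosed) :
    IsRealBanachSpace (leftProductSpace T) (leftProductNorm T) :=
  isDominatingNorm_traceNorm.isRealBanachSpace_of_isClosed_graph isDominatingNorm_traceNorm
    (isClosed_leftProductGraph hT)
    (fun _ hγ => ContinuousLinearMap.ext fun f => eq_of_mem_graph (hγ.2 f) T.graph.zero_mem)
    (fun _ => mem_leftProductSpace_iff) fun _ _ h => h.2.leftProductNorm_eq

end Completeness

/-! ### Self-adjoint operators and their resolvents -/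

section SelfAdjoint

variable {H : Type*} [NormedAddCommGroup H] [InnerProductSpace ℂ H] [CompleteSpace H]
  {A : H →ₗ.[ℂ] H}

theorem mem_graph_iff_inner_eq (hA : IsSelfAdjoint A) {u v : H} :
    (u, v) ∈ A.graph ↔ ∀ f g, (f, g) ∈ A.graph → inner ℂ g u = inner ℂ f v := by
  conv_lhs => rw [← LinearPMap.isSelfAdjoint_def.1 hA]
  rw [LinearPMap.adjoint_graph_eq_graph_adjoint hA.dense_domain, Submodule.mem_adjoint_iff]
  simp only [sub_eq_zero]

theorem isSelfAdjoint_of_symmetric_of_surjective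
    (hsymm : ∀ f g u v, (f, g) ∈ A.graph → (u, v) ∈ A.graph → inner ℂ g u = inner ℂ f v)
    (hsurj : ∀ h, ∃ u, (u, h - u) ∈ A.graph) : IsSelfAdjoint A := by
  have hadjoint : ∀ u v, (∀ f g, (f, g) ∈ A.graph → inner ℂ g u = inner ℂ f v) →
      (u, v) ∈ A.graph := by
    intro u v huv
    obtain ⟨w, hw⟩ := hsurj (u + v)
    obtain ⟨f, hf⟩ := hsurj (u - w)
    have horth : inner ℂ (u - w - f) (u - w) = inner ℂ f (v - (u + v - w)) := by
      rw [inner_sub_right, inner_sub_right, huv f _ hf, hsymm f _ w _ hf hw]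
    have huw : u - w = 0 := by
      rw [show v - (u + v - w) = -(u - w) by abel, inner_neg_right, inner_sub_left,
        sub_eq_iff_eq_add, neg_add_cancel] at horth
      exact inner_self_eq_zero.1 horth
    obtain rfl := sub_eq_zero.1 huw
    rwa [add_sub_cancel_left] at hw
  have hdense : Dense (A.domain : Set H) := by
    rw [Submodule.dense_iff_topologicalClosure_eq_top, Submodule.topologicalClosure_eq_top_iff,
      Submodule.eq_bot_iff]
    intro z hz
    refine eq_of_mem_graph (hadjoint 0 z fun f g hfg => ?_) A.graph.zero_mem
    rw [inner_zero_right, hz f (LinearPMap.mem_domain_of_mem_graph hfg)]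
  refine LinearPMap.isSelfAdjoint_def.2 (LinearPMap.eq_of_eq_graph (SetLike.ext ?_))
  rintro ⟨u, v⟩
  rw [LinearPMap.adjoint_graph_eq_graph_adjoint hdense, Submodule.mem_adjoint_iff]
  simp only [sub_eq_zero]
  exact ⟨hadjoint u v, fun h f g hfg => hsymm f g u v hfg h⟩

/-- `P = s (s + A²)⁻¹` and `B = A P`, expressed through the graph of `A`. For `s → ∞` the `P` tend
to the identity; they serve to cut `A` off to a bounded operator. -/
structure IsCutoff (A : H →ₗ.[ℂ] H) (s : ℝ) (P B : H →L[ℂ] H) : Prop where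
  mem_graph : ∀ x, (P x, B x) ∈ A.graph
  mem_graph_sub : ∀ x, (B x, (s : ℂ) • (x - P x)) ∈ A.graph

/-- The projection of `(x, 0)` onto the graph of `s^{-1/2} A` is `(P x, s^{-1/2} B x)`. -/
theorem exists_isCutoff (hA : IsSelfAdjoint A) {s : ℝ} (hs : 0 < s) :
    ∃ P B, IsCutoff A s P B := by
  have hr : ((√s : ℝ) : ℂ) ≠ 0 := Complex.ofReal_ne_zero.2 (Real.sqrt_pos.2 hs).ne'
  have hrr : ((√s : ℝ) : ℂ) * (√s : ℝ) = s := by exact_mod_cast Real.mul_self_sqrt hs.le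
  let L : WithLp 2 (H × H) →L[ℂ] H × H :=
    (WithLp.fstL 2 ℂ H H).prod (((√s : ℝ) : ℂ) • WithLp.sndL 2 ℂ H H)
  let K : Submodule ℂ (WithLp 2 (H × H)) := A.graph.comap (L : WithLp 2 (H × H) →ₗ[ℂ] H × H)
  have hK : IsClosed (K : Set (WithLp 2 (H × H))) := hA.isClosed.preimage L.continuous
  have : CompleteSpace K := hK.completeSpace_coe
  let R : H →L[ℂ] H × H := L ∘L K.starProjection ∘L
    ((WithLp.prodContinuousLinearEquiv 2 ℂ H H).symm : H × H →L[ℂ] WithLp 2 (H × H)) ∘L .inl ℂ H H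
  refine ⟨.fst ℂ H H ∘L R, .snd ℂ H H ∘L R, fun x => K.starProjection_apply_mem _, fun x => ?_⟩
  refine (mem_graph_iff_inner_eq hA).2 fun f g hfg => ?_
  have hmem : WithLp.toLp 2 (f, ((√s : ℝ) : ℂ)⁻¹ • g) ∈ K := by
    change (f, ((√s : ℝ) : ℂ) • ((√s : ℝ) : ℂ)⁻¹ • g) ∈ A.graph
    rwa [smul_inv_smul₀ hr]
  let q := K.starProjection (WithLp.toLp 2 (x, 0))
  have horth := (Submodule.mem_orthogonal _ _).1
    (K.sub_starProjection_mem_orthogonal (WithLp.toLp 2 (x, 0))) _ hmem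
  change inner ℂ f (x - q.fst) + inner ℂ (((√s : ℝ) : ℂ)⁻¹ • g) (0 - q.snd) = 0 at horth
  change inner ℂ g (((√s : ℝ) : ℂ) • q.snd) = inner ℂ f ((s : ℂ) • (x - q.fst))
  rw [zero_sub, inner_neg_right, add_neg_eq_zero, inner_smul_left, map_inv₀, Complex.conj_ofReal,
    eq_inv_mul_iff_mul_eq₀ hr] at horth
  rw [inner_smul_right, inner_smul_right, ← horth, ← mul_assoc, hrr]

namespace IsCutoff

variable {s : ℝ} {P B : H →L[ℂ] H}

theorem inner_sub_left (hA : IsSelfAdjoint A) (h : IsCutoff A s P B) (x y : H) :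
    (s : ℂ) * inner ℂ (x - P x) (P y) = inner ℂ (B x) (B y) := by
  rw [← (mem_graph_iff_inner_eq hA).1 (h.mem_graph y) _ _ (h.mem_graph_sub x), inner_smul_left,
    Complex.conj_ofReal]

theorem inner_sub_right (hA : IsSelfAdjoint A) (h : IsCutoff A s P B) (x y : H) :
    (s : ℂ) * inner ℂ (P x) (y - P y) = inner ℂ (B x) (B y) := by
  rw [(mem_graph_iff_inner_eq hA).1 (h.mem_graph_sub y) _ _ (h.mem_graph x), inner_smul_right]

theorem isSelfAdjoint_left (hA : IsSelfAdjoint A) (hs : 0 < s) (h : IsCutoff A s P B) :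
    IsSelfAdjoint P := by
  refine isSelfAdjoint_iff_isSymmetric.2 fun x y => ?_
  have hs' : (s : ℂ) ≠ 0 := Complex.ofReal_ne_zero.2 hs.ne'
  have hsub := mul_left_cancel₀ hs'
    ((h.inner_sub_right hA x y).trans (h.inner_sub_left hA x y).symm)
  rw [_root_.inner_sub_left, _root_.inner_sub_right] at hsub
  exact sub_left_inj.1 hsub

theorem isSelfAdjoint_right (hA : IsSelfAdjoint A) (hs : 0 < s) (h : IsCutoff A s P B) :
    IsSelfAdjoint B := by
  refine isSelfAdjoint_iff_isSymmetric.2 fun x y => ?_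
  have hs' : (s : ℂ) ≠ 0 := Complex.ofReal_ne_zero.2 hs.ne'
  have hP : inner ℂ (B x) (P y) = inner ℂ (P x) (B y) :=
    (mem_graph_iff_inner_eq hA).1 (h.mem_graph y) _ _ (h.mem_graph x)
  have hsub : inner ℂ (B x) (y - P y) = inner ℂ (x - P x) (B y) := by
    have := (mem_graph_iff_inner_eq hA).1 (h.mem_graph_sub y) _ _ (h.mem_graph_sub x)
    rw [inner_smul_left, inner_smul_right, Complex.conj_ofReal] at this
    exact (mul_left_cancel₀ hs' this).symm
  rw [_root_.inner_sub_left, _root_.inner_sub_right, hP] at hsub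
  exact sub_left_inj.1 hsub

theorem norm_sq_add_le (hA : IsSelfAdjoint A) (hs : 0 < s) (h : IsCutoff A s P B) (x : H) :
    s * ‖P x‖ ^ 2 + 2 * ‖B x‖ ^ 2 ≤ s * ‖x‖ ^ 2 := by
  have hB : s * (inner ℂ (P x) (x - P x)).re = ‖B x‖ ^ 2 := by
    rw [← Complex.re_ofReal_mul, h.inner_sub_right hA]
    exact inner_self_eq_norm_sq (𝕜 := ℂ) (B x)
  have hx := norm_add_sq (𝕜 := ℂ) (P x) (x - P x)
  rw [add_sub_cancel, RCLike.re_to_complex] at hx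
  nlinarith [mul_nonneg hs.le (sq_nonneg ‖x - P x‖)]

theorem norm_le_one (hA : IsSelfAdjoint A) (hs : 0 < s) (h : IsCutoff A s P B) : ‖P‖ ≤ 1 := by
  refine P.opNorm_le_bound zero_le_one fun x => ?_
  rw [one_mul, ← sq_le_sq₀ (norm_nonneg _) (norm_nonneg _)]
  nlinarith [h.norm_sq_add_le hA hs x, sq_nonneg ‖B x‖]

theorem right_apply (hA : IsSelfAdjoint A) (hs : 0 < s) (h : IsCutoff A s P B) {f g : H}
    (hfg : (f, g) ∈ A.graph) : B f = P g := by
  refine ext_inner_right ℂ fun y => ?_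
  have hB := isSelfAdjoint_iff_isSymmetric.1 (h.isSelfAdjoint_right hA hs) f y
  have hP := isSelfAdjoint_iff_isSymmetric.1 (h.isSelfAdjoint_left hA hs) g y
  exact hB.trans (((mem_graph_iff_inner_eq hA).1 (h.mem_graph y) _ _ hfg).symm.trans hP.symm)

theorem map_mem_graph (hA : IsSelfAdjoint A) (hs : 0 < s) (h : IsCutoff A s P B) {f g : H}
    (hfg : (f, g) ∈ A.graph) : (P f, P g) ∈ A.graph :=
  h.right_apply hA hs hfg ▸ h.mem_graph f

theorem right_apply_eq_smul_sub (hA : IsSelfAdjoint A) (hs : 0 < s) (h : IsCutoff A s P B)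
    {f g : H} (hfg : (f, g) ∈ A.graph) : B g = (s : ℂ) • (f - P f) :=
  eq_of_mem_graph (h.mem_graph g) (h.right_apply hA hs hfg ▸ h.mem_graph_sub f)

theorem norm_sub_sq_le (hA : IsSelfAdjoint A) (hs : 0 < s) (h : IsCutoff A s P B) {f g : H}
    (hfg : (f, g) ∈ A.graph) : ‖f - P f‖ ^ 2 ≤ ‖g‖ ^ 2 / s := by
  have hBg := h.norm_sq_add_le hA hs g
  rw [h.right_apply_eq_smul_sub hA hs hfg, norm_smul, Complex.norm_real, Real.norm_of_nonneg hs.le,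
    mul_pow] at hBg
  rw [le_div_iff₀ hs]
  have := mul_nonneg hs.le (sq_nonneg ‖P g‖)
  refine le_of_mul_le_mul_left ?_ hs
  nlinarith [mul_nonneg (sq_nonneg s) (sq_nonneg ‖f - P f‖)]

end IsCutoff

theorem tendsto_isCutoff (hA : IsSelfAdjoint A) {κ : Type*} {l : Filter κ} {s : κ → ℝ}
    {P B : κ → H →L[ℂ] H} (h : ∀ k, IsCutoff A (s k) (P k) (B k)) (hs : ∀ k, 0 < s k)
    (hsl : Tendsto s l atTop) (x : H) : Tendsto (fun k => P k x) l (𝓝 x) := by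
  have hequi : Equicontinuous fun k => (P k : H → H) :=
    (LipschitzWith.uniformEquicontinuous _ 1 fun k =>
      (P k).lipschitz.weaken ((h k).norm_le_one hA (hs k))).equicontinuous
  have hclosed := hequi.isClosed_setOfPred_tendsto (l := l) continuous_id
  refine hA.dense_domain.induction (P := fun x => Tendsto (fun k => P k x) l (𝓝 x)) ?_ hclosed x
  intro f hf
  obtain ⟨g, hfg⟩ := LinearPMap.mem_domain_iff.1 hf
  have hsq : Tendsto (fun k => ‖f - P k f‖ ^ 2) l (𝓝 0) :=
    squeeze_zero (fun _ => sq_nonneg _) (fun k => (h k).norm_sub_sq_le hA (hs k) hfg)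
      (hsl.const_div_atTop _)
  rw [tendsto_iff_norm_sub_tendsto_zero]
  simpa [norm_sub_rev] using hsq.sqrt

end SelfAdjoint

/-! ### The square of a self-adjoint operator -/

section Square

variable {H : Type*} [NormedAddCommGroup H] [InnerProductSpace ℂ H]
  {A : H →ₗ.[ℂ] H} {ρ τ γ P B : H →L[ℂ] H} {s : ℝ}

theorem tendsto_compression_apply {κ : Type*} {l : Filter κ} {P : κ → H →L[ℂ] H}
    (hP : ∀ k, ‖P k‖ ≤ 1) (hP1 : ∀ x, Tendsto (fun k => P k x) l (𝓝 x)) (T : H →L[ℂ] H) (x : H) :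
    Tendsto (fun k => P k (T (P k x))) l (𝓝 (T x)) := by
  have hT : Tendsto (fun k => T (P k x) - T x) l (𝓝 0) := by
    simpa using ((T.continuous.tendsto x).comp (hP1 x)).sub_const (T x)
  have hdiff : Tendsto (fun k => P k (T (P k x) - T x)) l (𝓝 0) :=
    squeeze_zero_norm (fun k => ((P k).le_of_opNorm_le (hP k) _).trans_eq (one_mul _))
      (tendsto_zero_iff_norm_tendsto_zero.1 hT)
  simpa using hdiff.add (hP1 (T x))

theorem IsCutoff.isLeftProduct_compression (h : IsCutoff A s P B) :
    IsLeftProduct (pcomp A A) (P ∘L ρ ∘L P) ((s : ℂ) • (ρ ∘L P - P ∘L ρ ∘L P)) := fun x =>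
  mem_graph_pcomp_iff.2 ⟨B (ρ (P x)), h.mem_graph _, h.mem_graph_sub _⟩

variable [CompleteSpace H]

theorem IsCutoff.mem_graph_pcomp_self_iff (hA : IsSelfAdjoint A) (h : IsCutoff A 1 P B) {f k : H} :
    (f, k) ∈ (pcomp A A).graph ↔ P (f + k) = f := by
  rw [mem_graph_pcomp_iff]
  constructor
  · rintro ⟨g, hfg, hgk⟩
    have hf := h.right_apply_eq_smul_sub hA one_pos hfg
    rw [h.right_apply hA one_pos hgk, Complex.ofReal_one, one_smul] at hf
    rw [map_add, hf, add_sub_cancel]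
  · intro hf
    have hg := h.mem_graph (f + k)
    have hk := h.mem_graph_sub (f + k)
    rw [hf] at hg
    rw [hf, Complex.ofReal_one, one_smul, add_sub_cancel_left] at hk
    exact ⟨B (f + k), hg, hk⟩

theorem isClosed_pcomp_self (hA : IsSelfAdjoint A) : (pcomp A A).IsClosed := by
  obtain ⟨P, B, h⟩ := exists_isCutoff hA one_pos
  have hgraph : ((pcomp A A).graph : Set (H × H)) = {p | P (p.1 + p.2) = p.1} :=
    Set.ext fun _ => h.mem_graph_pcomp_self_iff hA
  rw [LinearPMap.IsClosed, hgraph]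
  exact isClosed_eq (by fun_prop) continuous_fst

theorem IsLeftProduct.exists_factor (hA : IsSelfAdjoint A) (hγ : IsLeftProduct (pcomp A A) ρ γ) :
    ∃ β : H →L[ℂ] H, IsLeftProduct A ρ β ∧ ∀ x, (β x, γ x) ∈ A.graph := by
  obtain ⟨P, B, h⟩ := exists_isCutoff hA one_pos
  have hP : ∀ x, P (ρ x + γ x) = ρ x := fun x => (h.mem_graph_pcomp_self_iff hA).1 (hγ x)
  refine ⟨B ∘L (ρ + γ), fun x => ?_, fun x => ?_⟩
  · simpa [hP x] using h.mem_graph (ρ x + γ x)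
  · simpa [hP x] using h.mem_graph_sub (ρ x + γ x)

theorem exists_isSandwich_of_bound (hA : Dense (A.domain : Set H)) {β : H →L[ℂ] H}
    (hβ : IsLeftProduct A ρ β) {C : ℝ} (hC : ∀ f g, (f, g) ∈ A.graph → ‖β g‖ ≤ C * ‖f‖) :
    ∃ τ : H →L[ℂ] H, IsSandwich A ρ τ := by
  let βA : A.domain →ₗ[ℂ] H := (β : H →ₗ[ℂ] H) ∘ₗ A.toFun
  have hext := LinearMap.extendOfNorm_eq (f := βA) (e := A.domain.subtype) hA.denseRange_val
    ⟨C, fun f => hC f (A f) (A.mem_graph f)⟩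
  refine ⟨βA.extendOfNorm A.domain.subtype, fun f g hfg => ?_⟩
  obtain ⟨f, rfl, rfl⟩ := A.mem_graph_iff.1 hfg
  rw [← A.domain.subtype_apply f, hext f]
  exact hβ (A f)

namespace IsCutoff

theorem comp_comp_eq_of_isSandwich (hA : IsSelfAdjoint A) (hs : 0 < s) (h : IsCutoff A s P B)
    (hτ : IsSandwich A ρ τ) : B ∘L ρ ∘L B = P ∘L τ ∘L P :=
  ContinuousLinearMap.ext fun x => h.right_apply hA hs (hτ _ _ (h.mem_graph x))

theorem traceNorm_comp_comp_le (hA : IsSelfAdjoint A) (hs : 0 < s) (h : IsCutoff A s P B)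
    (hρ : IsSelfAdjoint ρ) (hρt : traceNorm ρ < ∞) {β : H →L[ℂ] H} (hβ : IsLeftProduct A ρ β)
    (hγ : ∀ x, (β x, γ x) ∈ A.graph) : traceNorm (B ∘L ρ ∘L B) ≤ traceNorm γ := by
  have hBBρ : B ∘L B ∘L ρ = P ∘L P ∘L γ := by
    ext x
    rw [comp_apply, comp_apply, h.right_apply hA hs (hβ x),
      h.right_apply hA hs (h.map_mem_graph hA hs (hγ x)), comp_apply, comp_apply]
  have hP := h.norm_le_one hA hs
  calc traceNorm (B ∘L ρ ∘L B)
      ≤ traceNorm (B ∘L B ∘L ρ) := traceNorm_conj_le hρ (h.isSelfAdjoint_right hA hs) hρt.ne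
    _ = traceNorm (P ∘L P ∘L γ) := by rw [hBBρ]
    _ ≤ traceNorm (P ∘L γ) := traceNorm_contraction_comp_le hP _
    _ ≤ traceNorm γ := traceNorm_contraction_comp_le hP _

end IsCutoff

/-- With `P → 1` the bounded operators `B ρ B = P (A ρ A) P` converge to `A ρ A` on the domain of
`A`, while `‖B ρ B‖₁ ≤ ‖B² ρ‖₁ = ‖P² A² ρ‖₁ ≤ ‖A² ρ‖₁`. -/
theorem IsLeftProduct.exists_isSandwich (hA : IsSelfAdjoint A) (hρ : IsSelfAdjoint ρ)
    (hρt : traceNorm ρ < ∞) (hγ : IsLeftProduct (pcomp A A) ρ γ) (hγt : traceNorm γ < ∞) :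
    ∃ τ, IsSandwich A ρ τ ∧ traceNorm τ < ∞ := by
  obtain ⟨β, hβ, hβγ⟩ := hγ.exists_factor hA
  have hs : ∀ n : ℕ, (0 : ℝ) < n + 1 := fun n => n.cast_add_one_pos
  choose P B h using fun n => exists_isCutoff hA (hs n)
  have hP : ∀ n, ‖P n‖ ≤ 1 := fun n => (h n).norm_le_one hA (hs n)
  have hP1 := tendsto_isCutoff hA h hs (tendsto_natCast_atTop_atTop.atTop_add tendsto_const_nhds)
  have htrace : ∀ n, traceNorm (B n ∘L ρ ∘L B n) ≤ traceNorm γ := fun n =>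
    (h n).traceNorm_comp_comp_le hA (hs n) hρ hρt hβ hβγ
  have hnorm : ∀ n, ‖B n ∘L ρ ∘L B n‖ ≤ (traceNorm γ).toReal := fun n => by
    rw [← toReal_enorm]
    exact ENNReal.toReal_mono hγt.ne ((enorm_le_traceNorm _).trans (htrace n))
  have hbound : ∀ f g, (f, g) ∈ A.graph → ‖β g‖ ≤ (traceNorm γ).toReal * ‖f‖ := by
    intro f g hfg
    refine le_of_tendsto (tendsto_compression_apply hP hP1 β g).norm (.of_forall fun n => ?_)
    rw [← (h n).right_apply hA (hs n) hfg, ← (h n).right_apply hA (hs n) (hβ (B n f))]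
    exact (B n ∘L ρ ∘L B n).le_of_opNorm_le (hnorm n) f
  obtain ⟨τ, hτ⟩ := exists_isSandwich_of_bound hA.dense_domain hβ hbound
  refine ⟨τ, hτ, (traceNorm_le_of_tendsto (T := fun n => P n ∘L τ ∘L P n)
    (tendsto_compression_apply hP hP1 τ) (.of_forall fun n => ?_)).trans_lt hγt⟩
  rw [← (h n).comp_comp_eq_of_isSandwich hA (hs n) hτ]
  exact htrace n

theorem leftProductSpace_pcomp_self_subset_sandwichSpace (hA : IsSelfAdjoint A) :
    leftProductSpace (pcomp A A) ⊆ sandwichSpace A := by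
  intro ρ hρ
  obtain ⟨γ, ⟨hρsa, hγ⟩, hρt, hγt⟩ := mem_leftProductSpace_iff.1 hρ
  obtain ⟨τ, hτ, hτt⟩ := hγ.exists_isSandwich hA hρsa hρt hγt
  exact (mem_sandwichSpace_iff hA.dense_domain).2 ⟨τ, ⟨hρsa, hτ⟩, hρt, hτt⟩

namespace IsCutoff

theorem isSandwich_compression (hA : IsSelfAdjoint A) (hs : 0 < s) (h : IsCutoff A s P B)
    (hτ : IsSandwich A ρ τ) : IsSandwich A (P ∘L ρ ∘L P) (P ∘L τ ∘L P) := fun _ _ hfg =>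
  h.map_mem_graph hA hs (hτ _ _ (h.map_mem_graph hA hs hfg))

theorem compression_mem_leftProductSpace (hA : IsSelfAdjoint A) (hs : 0 < s)
    (h : IsCutoff A s P B) (hρ : IsSelfAdjoint ρ) (hρt : traceNorm ρ < ∞) :
    P ∘L ρ ∘L P ∈ leftProductSpace (pcomp A A) := by
  have hP := h.norm_le_one hA hs
  have hsa : IsSelfAdjoint (P ∘L ρ ∘L P) := hρ.conjugate_self (h.isSelfAdjoint_left hA hs)
  have hρP : traceNorm (ρ ∘L P) < ∞ := (traceNorm_comp_contraction_le hP _).trans_lt hρt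
  have hPρP : traceNorm (P ∘L ρ ∘L P) < ∞ := (traceNorm_contraction_comp_le hP _).trans_lt hρP
  refine mem_leftProductSpace_iff.2 ⟨_, ⟨hsa, h.isLeftProduct_compression⟩, hPρP, ?_⟩
  exact (traceNorm_smul_le _ _).trans_lt (ENNReal.mul_lt_top enorm_lt_top
    ((traceNorm_sub_le _ _).trans_lt (ENNReal.add_lt_top.2 ⟨hρP, hPρP⟩)))

end IsCutoff

theorem exists_sandwichNorm_sub_lt (hA : IsSelfAdjoint A) (hρ : ρ ∈ sandwichSpace A) {ε : ℝ}
    (hε : 0 < ε) : ∃ σ ∈ leftProductSpace (pcomp A A), sandwichNorm A (ρ - σ) < ε := by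
  obtain ⟨τ, ⟨hρsa, hτ⟩, hρt, hτt⟩ := (mem_sandwichSpace_iff hA.dense_domain).1 hρ
  have hs : ∀ n : ℕ, (0 : ℝ) < n + 1 := fun n => n.cast_add_one_pos
  choose P B h using fun n => exists_isCutoff hA (hs n)
  have hP1 := tendsto_isCutoff hA h hs (tendsto_natCast_atTop_atTop.atTop_add tendsto_const_nhds)
  have hlim : ∀ T : H →L[ℂ] H, traceNorm T < ∞ →
      Tendsto (fun n => traceNorm (T - P n ∘L T ∘L P n)) atTop (𝓝 0) := fun T hT =>
    tendsto_traceNorm_sub_compression (fun n => (h n).norm_le_one hA (hs n))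
      (fun n => (h n).isSelfAdjoint_left hA (hs n)) hP1 hT.ne
  have hsum := (hlim ρ hρt).add (hlim τ hτt)
  rw [add_zero] at hsum
  obtain ⟨n, hn⟩ := (hsum.eventually_lt_const (ENNReal.ofReal_pos.2 hε)).exists
  have hsub : IsSandwich A (ρ - P n ∘L ρ ∘L P n) (τ - P n ∘L τ ∘L P n) := fun f g hfg =>
    A.graph.sub_mem (hτ f g hfg) ((h n).isSandwich_compression hA (hs n) hτ f g hfg)
  refine ⟨_, (h n).compression_mem_leftProductSpace hA (hs n) hρsa hρt, ?_⟩
  rw [hsub.sandwichNorm_eq hA.dense_domain]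
  exact (ENNReal.lt_ofReal_iff_toReal_lt (hn.trans ENNReal.ofReal_lt_top).ne).1 hn

end Square

theorem mainTheorem6_general {H : Type u} [NormedAddCommGroup H] [InnerProductSpace ℂ H]
    [CompleteSpace H] [NormedSpace ℝ H] [IsScalarTower ℝ ℂ H] {A : H →ₗ.[ℂ] H}
    (hA : IsSelfAdjoint A) :
    IsRealBanachSpace (sandwichSpace A) (sandwichNorm A) ∧
      IsRealBanachSpace (leftProductSpace (pcomp A A)) (leftProductNorm (pcomp A A)) ∧
      leftProductSpace (pcomp A A) ⊆ sandwichSpace A ∧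
      ∀ ρ ∈ sandwichSpace A, ∀ ε : ℝ, 0 < ε →
        ∃ σ ∈ leftProductSpace (pcomp A A), sandwichNorm A (ρ - σ) < ε :=
  ⟨isRealBanachSpace_sandwichSpace hA.isClosed hA.dense_domain,
    isRealBanachSpace_leftProductSpace (isClosed_pcomp_self hA),
    leftProductSpace_pcomp_self_subset_sandwichSpace hA,
    fun _ hρ _ hε => exists_sandwichNorm_sub_lt hA hρ hε⟩

/-! ### The operator `H₀^{1/2}` -/

section FreeHamiltonian

open MeasureTheory FourierTransform

theorem freeHamiltonian_eq_pcomp :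
    freeHamiltonian = pcomp sqrtFreeHamiltonian sqrtFreeHamiltonian := by
  refine LinearPMap.eq_of_eq_graph (SetLike.ext fun p => ?_)
  rw [graph_freeHamiltonian, mem_freeHamiltonianGraph_iff_sqrt p.1 p.2, mem_graph_pcomp_iff,
    graph_sqrtFreeHamiltonian]

theorem inner_eq_of_mem_sqrtFreeHamiltonianGraph {f g u v : L2}
    (hfg : (f, g) ∈ sqrtFreeHamiltonianGraph) (huv : (u, v) ∈ sqrtFreeHamiltonianGraph) :
    inner ℂ g u = inner ℂ f v := by
  rw [← Lp.inner_fourier_eq, ← Lp.inner_fourier_eq f, L2.inner_def, L2.inner_def]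
  refine integral_congr_ae ?_
  filter_upwards [hfg, huv] with ξ hg hv
  rw [hg, hv, RCLike.inner_apply, RCLike.inner_apply, map_mul, Complex.conj_ofReal]
  ring

theorem memLp_mul_inv_one_add {α : Type*} [MeasurableSpace α] {μ : Measure α} {p : ℝ≥0∞}
    {φ : α → ℝ} (hφ : Measurable φ) (hφ0 : ∀ x, 0 ≤ φ x) {f : α → ℂ} (hf : MemLp f p μ) :
    MemLp (fun x => ((1 + φ x : ℝ) : ℂ)⁻¹ * f x) p μ := by
  have hinv : Measurable fun x => ((1 + φ x : ℝ) : ℂ)⁻¹ :=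
    (Complex.measurable_ofReal.comp (hφ.const_add 1)).inv
  refine hf.mono (hinv.aestronglyMeasurable.mul hf.1) (.of_forall fun x => ?_)
  have hx : 1 ≤ 1 + φ x := le_add_of_nonneg_right (hφ0 x)
  rw [norm_mul, norm_inv, Complex.norm_of_nonneg (zero_le_one.trans hx)]
  exact mul_le_of_le_one_left (norm_nonneg _) (inv_le_one_of_one_le₀ hx)

theorem exists_mem_sqrtFreeHamiltonianGraph_sub (h : L2) :
    ∃ u, (u, h - u) ∈ sqrtFreeHamiltonianGraph := by
  have hmem := memLp_mul_inv_one_add (φ := fun ξ => 2 * Real.pi * ‖ξ‖ / √2) (by fun_prop)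
    (fun ξ => by positivity) (Lp.memLp (𝓕 h : L2))
  refine ⟨𝓕⁻ (hmem.toLp _), ?_⟩
  change ∀ᵐ ξ, (𝓕 (h - 𝓕⁻ (hmem.toLp _)) : L2) ξ = _ * (𝓕 (𝓕⁻ (hmem.toLp _)) : L2) ξ
  have hsub : (𝓕 (h - 𝓕⁻ (hmem.toLp _)) : L2) = 𝓕 h - 𝓕 (𝓕⁻ (hmem.toLp _) : L2) :=
    map_sub (Lp.fourierTransformₗᵢ (EuclideanSpace ℝ (Fin 3)) ℂ) _ _
  rw [hsub, FourierTransform.fourier_fourierInv_eq]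
  filter_upwards [Lp.coeFn_sub (𝓕 h : L2) (hmem.toLp _), hmem.coeFn_toLp] with ξ hξ hu
  have hne : ((1 + 2 * Real.pi * ‖ξ‖ / √2 : ℝ) : ℂ) ≠ 0 := by
    exact_mod_cast (by positivity : 1 + 2 * Real.pi * ‖ξ‖ / √2 ≠ 0)
  rw [hξ, Pi.sub_apply, hu, sub_eq_iff_eq_add, ← add_one_mul, ← Complex.ofReal_one,
    ← Complex.ofReal_add, add_comm, mul_inv_cancel_left₀ hne]

theorem isSelfAdjoint_sqrtFreeHamiltonian : IsSelfAdjoint sqrtFreeHamiltonian := by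
  refine isSelfAdjoint_of_symmetric_of_surjective ?_ ?_ <;> rw [graph_sqrtFreeHamiltonian]
  · exact fun f g u v => inner_eq_of_mem_sqrtFreeHamiltonianGraph
  · exact exists_mem_sqrtFreeHamiltonianGraph_sub

end FreeHamiltonian

end HartreeFock

theorem mainTheorem6 :
    HartreeFock.IsRealBanachSpace HartreeFock.Z HartreeFock.normZ ∧
    HartreeFock.IsRealBanachSpace HartreeFock.Y HartreeFock.normY ∧
    HartreeFock.Y ⊆ HartreeFock.Z ∧
    ∀ ρ ∈ HartreeFock.Z, ∀ ε : ℝ, 0 < ε →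
      ∃ σ ∈ HartreeFock.Y, HartreeFock.normZ (ρ - σ) < ε := by
  have h := HartreeFock.mainTheorem6_general HartreeFock.isSelfAdjoint_sqrtFreeHamiltonian
  rw [← HartreeFock.freeHamiltonian_eq_pcomp] at h
  exact h

end
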